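/- In the hexagonal lattice drawn with vertical edges, index the hexagonal cells by pairs $(a,b)$ of integers so that passing from $(a,b)$ to $(a+1,b)$ is a step to the lower-left neighbouring hexagon and passing to $(a,b+1)$ is a step to the lower-right neighbouring hexagon. For integers $n_1,n_2,m_1,m_2\ge 0$ let the ribbon $Rb(n_1,n_2,m_1,m_2)$ be the graph formed by all vertices and edges of the hexagons $(a,b)$ with either $0\le a<n_1+n_2,\ 0\le b<m_1$, or $n_2\le a<n_1+n_2,\ 0\le b<m_1+m_2$; that is, the union of two parallelograms of hexagons, of sizes $(n_1+n_2)\times m_1$ and $n_1\times(m_1+m_2)$, meeting in a common $n_1\times m_1$ corner. A Kekulé structure of a graph $B$ is a spanning subgraph all of whose components are $K_2$; a Clar cover of $B$ is a spanning subgraph each of whose components is $K_2$ or a hexagon $C_6$. Let $K\{B\}$ and $C\{B\}$ be the numbers of Kekulé structures and of Clar covers of $B$, and let $\mathrm{ZZ}(B,x)=\sum_{k=0}^{Cl}c_k x^k$, where $c_k$ is the number of Clar covers of $B$ with exactly $k$ components $C_6$ and $Cl$ is the largest number of components $C_6$ in a Clar cover. Then for $B=Rb(n_1,n_2,m_1,m_2)$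 \[ K\{B\}=\mathrm{ZZ}(B,0)=\sum_{k=0}^{\min(n_1,m_1)}\sum_{j=0}^{m_1-k}\sum_{i=0}^{n_1-k}\binom{m_1-k}{j}\binom{n_2+k}{j}\binom{m_2+k}{i}\binom{n_1-k}{i} \] and \[ C\{B\}=\mathrm{ZZ}(B,1)=\sum_{k=0}^{\min(n_1,m_1)}\sum_{j=0}^{m_1-k}\sum_{i=0}^{n_1-k}\binom{m_1-k}{j}\binom{n_2+k}{j}\binom{m_2+k}{i}\binom{n_1-k}{i}2^{i+j} +\sum_{k=1}^{\min(n_1,m_1)}\sum_{j=0}^{m_1-k}\sum_{i=0}^{n_1-k}\binom{m_1-k}{j}\binom{n_2-1+k}{j}\binom{m_2-1+k}{i}\binom{n_1-k}{i}2^{i+j}. \] -/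

import Mathlib

/-! ### Kekulé structures, Clar covers and the Zhang–Zhang polynomial of a graph

A spanning subgraph of `G : SimpleGraph V` is a graph `H : SimpleGraph V` on the same
vertex set with `H ≤ G`. -/

/-- The component `c` of `H` is a double bond, i.e. a complete graph on two vertices. -/
def IsDoubleBond {V : Type*} {H : SimpleGraph V} (c : H.ConnectedComponent) : Prop :=
  Nonempty (c.toSimpleGraph ≃g SimpleGraph.completeGraph (Fin 2))

/-- The component `c` of `H` is an aromatic sextet, i.e. a cycle on six vertices. -/
def IsSextet {V : Type*} {H : SimpleGraph V} (c : H.ConnectedComponent) : Prop :=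
  Nonempty (c.toSimpleGraph ≃g SimpleGraph.cycleGraph 6)

/-- A Kekulé structure: a spanning subgraph all of whose components are `K₂`. -/
def IsKekule {V : Type*} (G H : SimpleGraph V) : Prop :=
  H ≤ G ∧ ∀ c : H.ConnectedComponent, IsDoubleBond c

/-- A Clar cover: a spanning subgraph all of whose components are `K₂` or hexagons `C₆`. -/
def IsClarCover {V : Type*} (G H : SimpleGraph V) : Prop :=
  H ≤ G ∧ ∀ c : H.ConnectedComponent, IsDoubleBond c ∨ IsSextet c

/-- The order of a Clar cover: the number of its aromatic sextets. -/
noncomputable def clarOrder {V : Type*} (H : SimpleGraph V) : ℕ :=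
  Nat.card {c : H.ConnectedComponent // IsSextet c}

/-- The number of Kekulé structures. -/
noncomputable def numKekule {V : Type*} (G : SimpleGraph V) : ℕ :=
  Nat.card {H : SimpleGraph V // IsKekule G H}

/-- The number of Clar covers. -/
noncomputable def numClarCovers {V : Type*} (G : SimpleGraph V) : ℕ :=
  Nat.card {H : SimpleGraph V // IsClarCover G H}

/-- The number `c_k` of Clar covers of order `k`. -/
noncomputable def numClarCoversOfOrder {V : Type*} (G : SimpleGraph V) (k : ℕ) : ℕ :=
  Nat.card {H : SimpleGraph V // IsClarCover G H ∧ clarOrder H = k}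

/-- The Clar number: the maximal order of a Clar cover. -/
noncomputable def clarNumber {V : Type*} (G : SimpleGraph V) : ℕ :=
  sSup {k | ∃ H : SimpleGraph V, IsClarCover G H ∧ clarOrder H = k}

/-- The Zhang–Zhang polynomial `∑_{k=0}^{Cl} c_k x^k`. -/
noncomputable def zzPolynomial {V : Type*} (G : SimpleGraph V) : Polynomial ℕ :=
  ∑ k ∈ Finset.range (clarNumber G + 1),
    Polynomial.C (numClarCoversOfOrder G k) * Polynomial.X ^ k

/-! ### Benzenoids in the hexagonal lattice

The regular hexagons of the lattice (with two vertical sides, side length `1`) are indexed by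
cells `(a, b)`; the centre of the cell `(a, b)` is `(√3/2 · (b - a), -3/2 · (a + b))`, so that
`a` counts steps down-left and `b` counts steps down-right. Every lattice vertex is the top
vertex of exactly one hexagon or the bottom vertex of exactly one hexagon. -/

/-- `A a b` is the top vertex of the cell `(a, b)`; `B a b` is the bottom vertex of the cell
`(a - 1, b - 1)`, that is, the vertex vertically above `A a b` at distance `1`. -/
inductive HexVertex : Type
  | A (a b : ℕ) : HexVertex
  | B (a b : ℕ) : HexVertex
  deriving DecidableEq

/-- The lattice edges: `A a b` is joined to the vertex `B a b` above it and to the vertices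
`B (a + 1) b` and `B a (b + 1)`, its lower left and lower right neighbours. -/
def honeycomb : SimpleGraph HexVertex :=
  SimpleGraph.fromRel fun u v =>
    ∃ a b : ℕ, u = .A a b ∧ (v = .B a b ∨ v = .B (a + 1) b ∨ v = .B a (b + 1))

/-- The six vertices of the cell `(a, b)`, clockwise from the top. -/
def hexagon (h : ℕ × ℕ) : Finset HexVertex :=
  {.A h.1 h.2, .B h.1 (h.2 + 1), .A h.1 (h.2 + 1),
    .B (h.1 + 1) (h.2 + 1), .A (h.1 + 1) h.2, .B (h.1 + 1) h.2}

/-- The graph formed by the vertices and the edges of the hexagons in the set `S` of cells. -/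
def benzenoid (S : Set (ℕ × ℕ)) : SimpleGraph {v : HexVertex // ∃ h ∈ S, v ∈ hexagon h} where
  Adj u v := honeycomb.Adj u.1 v.1 ∧ ∃ h ∈ S, u.1 ∈ hexagon h ∧ v.1 ∈ hexagon h
  symm := ⟨fun _ _ ⟨e, h, hS, hu, hv⟩ => ⟨e.symm, h, hS, hv, hu⟩⟩
  loopless := ⟨fun _ h => h.1.ne rfl⟩

/-- The cells of the ribbon `Rb(n₁, n₂, m₁, m₂)`: the union of the parallelogram of
`(n₁ + n₂) × m₁` cells running down-left and the parallelogram of `n₁ × (m₁ + m₂)` cells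
running down-right, whose common corner is a parallelogram of `n₁ × m₁` cells. -/
def ribbonCells (n₁ n₂ m₁ m₂ : ℕ) : Set (ℕ × ℕ) :=
  {h | (h.1 < n₂ + n₁ ∧ h.2 < m₁) ∨ (n₂ ≤ h.1 ∧ h.1 < n₂ + n₁ ∧ h.2 < m₁ + m₂)}

/-- The ribbon `Rb(n₁, n₂, m₁, m₂)`. -/
abbrev ribbon (n₁ n₂ m₁ m₂ : ℕ) :
    SimpleGraph {v : HexVertex // ∃ h ∈ ribbonCells n₁ n₂ m₁ m₂, v ∈ hexagon h} :=
  benzenoid (ribbonCells n₁ n₂ m₁ m₂)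

/-! Covers become tilings, and tilings become lattice paths. Since every six-cycle of the honeycomb
bounds a cell, a Clar cover amounts to a partition of the vertex set into edges and hexagons, and a
Kekulé structure to one into edges (`card_isCover`). A proposition `e`, saying whether hexagons are
allowed, treats both cases at once.

When n₁, m₁ > 0, every position (a, b) of the ribbon carries a vertical pair A, B, except that the
top position (the source) lacks B and the bottom one (the sink) lacks A. The A at the source is
covered by its lower-left edge, its lower-right edge or the hexagon below it. All positions no
longer reachable are then balanced, so vertical edges are forced there
(`numTilings_filter_not_mem`), and the position reached is the new source. Thus a tiling is a path
to the sink with unit steps (edges) and, if `e` holds, diagonal steps (hexagons):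
`IsRegion.numTilings_pathRest`. On a rectangle this yields the numbers `delannoy x`, with x = 1 for
Kekulé structures and x = 2 for Clar covers.

In a ribbon, cut along the antidiagonal through the inner corner (n₂, m₁). A path either visits it
at (n₂ + k, m₁ - k), or jumps over it from (n₂ + k - 1, m₁ - k) to (n₂ + k, m₁ - k + 1). Before and
after the cut the path sees only a rectangle, so each case contributes a product of two `delannoy`
values. These are the two sums over k (`delannoy_split`, `IsRegion.numTilings_ribbon`). -/

/-! ### Weighted Delannoy numbers. -/

/-- The number of lattice paths from `(0, 0)` to `(n, m)` with unit steps and diagonal steps,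
where diagonal steps come in `x - 1` colours. -/
def delannoy (x n m : ℕ) : ℕ :=
  ∑ j ∈ Finset.range (m + 1), m.choose j * n.choose j * x ^ j

theorem delannoy_eq_sum_range (x n m K : ℕ) (h : m < K) :
    delannoy x n m = ∑ j ∈ Finset.range K, m.choose j * n.choose j * x ^ j := by
  unfold delannoy
  apply Finset.sum_subset
  · intro j hj
    simp only [Finset.mem_range] at *
    omega
  · intro j _ hj
    simp only [Finset.mem_range] at hj
    rw [Nat.choose_eq_zero_of_lt (by omega)]
    simp

theorem delannoy_comm (x n m : ℕ) : delannoy x n m = delannoy x m n := by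
  rw [delannoy_eq_sum_range x n m (n + m + 1) (by omega),
    delannoy_eq_sum_range x m n (n + m + 1) (by omega)]
  exact Finset.sum_congr rfl fun j _ => by ring

@[simp]
theorem delannoy_zero_right (x n : ℕ) : delannoy x n 0 = 1 := by
  simp [delannoy]

@[simp]
theorem delannoy_zero_left (x m : ℕ) : delannoy x 0 m = 1 := by
  rw [delannoy_comm, delannoy_zero_right]

/-- Pascal's rule in both binomials, coefficient by coefficient in powers of 1 + e. Adding `delannoy
(1 + e) n m` to both sides first avoids subtraction. -/
theorem delannoy_succ_succ (e n m : ℕ) :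
    delannoy (1 + e) (n + 1) (m + 1) =
      delannoy (1 + e) n (m + 1) + delannoy (1 + e) (n + 1) m + e * delannoy (1 + e) n m := by
  have h : delannoy (1 + e) (n + 1) (m + 1) + delannoy (1 + e) n m =
      delannoy (1 + e) n (m + 1) + delannoy (1 + e) (n + 1) m +
        (1 + e) * delannoy (1 + e) n m := by
    rw [delannoy_eq_sum_range (1 + e) (n + 1) (m + 1) (m + 1 + 1) (by omega),
      delannoy_eq_sum_range (1 + e) n (m + 1) (m + 1 + 1) (by omega),
      delannoy_eq_sum_range (1 + e) (n + 1) m (m + 1 + 1) (by omega)]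
    have h1 : (1 + e) * delannoy (1 + e) n m =
        ∑ j ∈ Finset.range (m + 1), m.choose j * n.choose j * (1 + e) ^ (j + 1) := by
      rw [delannoy, Finset.mul_sum]
      exact Finset.sum_congr rfl fun j _ => by ring
    rw [h1, delannoy_eq_sum_range (1 + e) n m (m + 1 + 1) (by omega)]
    -- Four of the sums have a term j = 0, equal to 1, two on each side; the fifth was shifted by
    -- the factor 1 + e and has none.
    simp only [Finset.sum_range_succ' _ (m + 1)]
    have h2 : ∀ A B C D E : ℕ, A + B = C + D + E →
        (A + 1) + (B + 1) = (C + 1) + (D + 1) + E := by intros; omega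
    simp only [Nat.choose_zero_right, pow_zero, mul_one]
    apply h2
    simp only [← Finset.sum_add_distrib]
    apply Finset.sum_congr rfl
    intro j _
    simp only [Nat.choose_succ_succ]
    ring
  have : (1 + e) * delannoy (1 + e) n m =
    delannoy (1 + e) n m + e * delannoy (1 + e) n m := by ring
  omega

open Finset.HasAntidiagonal (antidiagonal) in
/-- A solution of the Delannoy recurrence is determined by its values at the points where
paths meet an antidiagonal or jump over it. -/
theorem delannoy_split (e L : ℕ) (F : ℕ → ℕ → ℕ)
    (hF : ∀ a b, a + b < L → F a b = F (a + 1) b + F a (b + 1) + e * F (a + 1) (b + 1))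
    (d : ℕ) (hd : d < L) :
    F 0 0 = ∑ q ∈ antidiagonal (d + 1), delannoy (1 + e) q.1 q.2 * F q.1 q.2 +
      e * ∑ q ∈ antidiagonal d,
        delannoy (1 + e) q.1 q.2 * F (q.1 + 1) (q.2 + 1) := by
  induction d with
  | zero =>
    rw [hF 0 0 hd]
    simp [Finset.Nat.antidiagonal_succ]
    ring
  | succ d ih =>
    rw [ih (by omega)]
    -- Only points on the antidiagonal d + 1 are expanded. The earlier jumps already land on d + 2,
    -- where they merge with the new unit steps by the Delannoy recurrence.
    have h1 : ∑ q ∈ antidiagonal (d + 1), delannoy (1 + e) q.1 q.2 * F q.1 q.2 =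
        ∑ q ∈ antidiagonal (d + 1), delannoy (1 + e) q.1 q.2 * F (q.1 + 1) q.2 +
        ∑ q ∈ antidiagonal (d + 1), delannoy (1 + e) q.1 q.2 * F q.1 (q.2 + 1) +
        e * ∑ q ∈ antidiagonal (d + 1),
          delannoy (1 + e) q.1 q.2 * F (q.1 + 1) (q.2 + 1) := by
      rw [Finset.mul_sum, ← Finset.sum_add_distrib, ← Finset.sum_add_distrib]
      apply Finset.sum_congr rfl
      intro q hq
      rw [Finset.HasAntidiagonal.mem_antidiagonal] at hq
      rw [hF q.1 q.2 (by omega)]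
      ring
    have h2 : ∑ q ∈ antidiagonal (d + 1), delannoy (1 + e) q.1 q.2 * F q.1 (q.2 + 1) =
        F 0 (d + 1 + 1) +
        ∑ q ∈ antidiagonal d, delannoy (1 + e) (q.1 + 1) q.2 * F (q.1 + 1) (q.2 + 1) := by
      rw [Finset.Nat.sum_antidiagonal_succ]
      simp
    have h3 : ∑ q ∈ antidiagonal (d + 1), delannoy (1 + e) q.1 q.2 * F (q.1 + 1) q.2 =
        F (d + 1 + 1) 0 +
        ∑ q ∈ antidiagonal d, delannoy (1 + e) q.1 (q.2 + 1) * F (q.1 + 1) (q.2 + 1) := by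
      rw [Finset.Nat.sum_antidiagonal_succ']
      simp
    have h4 : ∑ q ∈ antidiagonal (d + 1 + 1), delannoy (1 + e) q.1 q.2 * F q.1 q.2 =
        F 0 (d + 1 + 1) + (F (d + 1 + 1) 0 + ∑ q ∈ antidiagonal d,
          delannoy (1 + e) (q.1 + 1) (q.2 + 1) * F (q.1 + 1) (q.2 + 1)) := by
      rw [Finset.Nat.sum_antidiagonal_succ, Finset.Nat.sum_antidiagonal_succ']
      simp
    have h5 : ∑ q ∈ antidiagonal d,
          delannoy (1 + e) (q.1 + 1) (q.2 + 1) * F (q.1 + 1) (q.2 + 1) =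
        ∑ q ∈ antidiagonal d, delannoy (1 + e) q.1 (q.2 + 1) * F (q.1 + 1) (q.2 + 1) +
        ∑ q ∈ antidiagonal d, delannoy (1 + e) (q.1 + 1) q.2 * F (q.1 + 1) (q.2 + 1) +
        e * ∑ q ∈ antidiagonal d,
          delannoy (1 + e) q.1 q.2 * F (q.1 + 1) (q.2 + 1) := by
      rw [Finset.mul_sum, ← Finset.sum_add_distrib, ← Finset.sum_add_distrib]
      apply Finset.sum_congr rfl
      intro q _
      rw [delannoy_succ_succ]
      ring
    rw [h1, h2, h3, h4, h5]
    ring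

/-! ### Exact covers -/

/-- `T` is a family of sets satisfying `Q` that covers every point of `U` exactly once. -/
def IsExactCover {α : Type*} (Q : Finset α → Prop) (U : Finset α)
    (T : Finset (Finset α)) : Prop :=
  (∀ τ ∈ T, Q τ ∧ τ ⊆ U) ∧ ∀ v ∈ U, ∃! τ, τ ∈ T ∧ v ∈ τ

open Classical in
/-- The exact covers of `U` by sets satisfying `Q`. -/
noncomputable def exactCovers {α : Type*} (Q : Finset α → Prop) (U : Finset α) :
    Finset (Finset (Finset α)) :=
  U.powerset.powerset.filter (IsExactCover Q U)

theorem mem_exactCovers {α : Type*} {Q : Finset α → Prop} {U : Finset α}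
    {T : Finset (Finset α)} : T ∈ exactCovers Q U ↔ IsExactCover Q U T := by
  classical
  simp only [exactCovers, Finset.mem_filter, Finset.mem_powerset, and_iff_right_iff_imp]
  intro h τ hτ
  exact Finset.mem_powerset.2 (h.1 τ hτ).2

theorem card_exactCovers_empty {α : Type*} {Q : Finset α → Prop}
    (hQ : ∀ τ, Q τ → τ.Nonempty) : (exactCovers Q ∅).card = 1 := by
  classical
  rw [Finset.card_eq_one]
  refine ⟨∅, ?_⟩
  ext T
  simp only [mem_exactCovers, IsExactCover, Finset.mem_singleton]
  constructor
  · rintro ⟨h, -⟩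
    refine Finset.eq_empty_of_forall_notMem fun τ hτ => ?_
    obtain ⟨v, hv⟩ := hQ τ (h τ hτ).1
    exact absurd ((h τ hτ).2 hv) (Finset.notMem_empty v)
  · rintro rfl
    simp

theorem isExactCover_insert {α : Type*} [DecidableEq α] {Q : Finset α → Prop}
    {U τ : Finset α} {T : Finset (Finset α)} (hτ : Q τ) (hU : τ ⊆ U)
    (h : IsExactCover Q (U \ τ) T) : IsExactCover Q U (insert τ T) := by
  refine ⟨fun σ hσ => ?_, fun v hv => ?_⟩
  · rcases Finset.mem_insert.1 hσ with rfl | hσ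
    · exact ⟨hτ, hU⟩
    · exact ⟨(h.1 σ hσ).1, (h.1 σ hσ).2.trans Finset.sdiff_subset⟩
  · by_cases hvτ : v ∈ τ
    · refine ⟨τ, ⟨Finset.mem_insert_self _ _, hvτ⟩, fun σ hσ => ?_⟩
      rcases Finset.mem_insert.1 hσ.1 with rfl | h'
      · rfl
      · exact absurd hvτ (Finset.mem_sdiff.1 ((h.1 σ h').2 hσ.2)).2
    · obtain ⟨σ, hσ, huniq⟩ := h.2 v (Finset.mem_sdiff.2 ⟨hv, hvτ⟩)
      refine ⟨σ, ⟨Finset.mem_insert_of_mem hσ.1, hσ.2⟩, fun ρ hρ => ?_⟩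
      rcases Finset.mem_insert.1 hρ.1 with rfl | h'
      · exact absurd hρ.2 hvτ
      · exact huniq ρ ⟨h', hρ.2⟩

theorem isExactCover_erase {α : Type*} [DecidableEq α] {Q : Finset α → Prop}
    {U τ : Finset α} {T : Finset (Finset α)} (hτ : τ ∈ T)
    (h : IsExactCover Q U T) : IsExactCover Q (U \ τ) (T.erase τ) := by
  refine ⟨fun σ hσ => ?_, fun v hv => ?_⟩
  · obtain ⟨hne, hσ⟩ := Finset.mem_erase.1 hσ
    refine ⟨(h.1 σ hσ).1, fun v hv => Finset.mem_sdiff.2 ⟨(h.1 σ hσ).2 hv, fun hvτ => hne ?_⟩⟩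
    exact (h.2 v ((h.1 σ hσ).2 hv)).unique ⟨hσ, hv⟩ ⟨hτ, hvτ⟩
  · obtain ⟨hvU, hvτ⟩ := Finset.mem_sdiff.1 hv
    obtain ⟨σ, hσ, huniq⟩ := h.2 v hvU
    refine ⟨σ, ⟨Finset.mem_erase.2 ⟨?_, hσ.1⟩, hσ.2⟩, fun ρ hρ =>
      huniq ρ ⟨Finset.mem_of_mem_erase hρ.1, hρ.2⟩⟩
    rintro rfl
    exact hvτ hσ.2

/-- Branching on the set which covers a given point. -/
theorem card_exactCovers_eq_sum {α : Type*} [DecidableEq α] {Q : Finset α → Prop}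
    {U : Finset α} {v : α} (hv : v ∈ U) (L : Finset (Finset α))
    (hL : ∀ τ, τ ∈ L ↔ Q τ ∧ τ ⊆ U ∧ v ∈ τ) :
    (exactCovers Q U).card = ∑ τ ∈ L, (exactCovers Q (U \ τ)).card := by
  have h : exactCovers Q U = L.biUnion fun τ => (exactCovers Q (U \ τ)).image (insert τ) := by
    ext T
    simp only [Finset.mem_biUnion, Finset.mem_image, mem_exactCovers]
    constructor
    · intro hT
      obtain ⟨τ, hτ, -⟩ := hT.2 v hv
      exact ⟨τ, (hL τ).2 ⟨(hT.1 τ hτ.1).1, (hT.1 τ hτ.1).2, hτ.2⟩, T.erase τ,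
        isExactCover_erase hτ.1 hT, Finset.insert_erase hτ.1⟩
    · rintro ⟨τ, hτ, T, hT, rfl⟩
      obtain ⟨h1, h2, -⟩ := (hL τ).1 hτ
      exact isExactCover_insert h1 h2 hT
  rw [h, Finset.card_biUnion]
  · refine Finset.sum_congr rfl fun τ hτ => Finset.card_image_of_injOn ?_
    have hne : ∀ T, IsExactCover Q (U \ τ) T → τ ∉ T := fun T hT h' =>
      (Finset.mem_sdiff.1 ((hT.1 τ h').2 ((hL τ).1 hτ).2.2)).2 ((hL τ).1 hτ).2.2
    intro T hT T' hT' he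
    have hT := hne T (mem_exactCovers.1 hT)
    have hT' := hne T' (mem_exactCovers.1 hT')
    rw [← Finset.erase_insert hT, ← Finset.erase_insert hT']
    exact congrArg (fun X => Finset.erase X τ) he
  · intro τ hτ σ hσ hne
    rw [Function.onFun, Finset.disjoint_left]
    intro T h1 h2
    simp only [Finset.mem_image, mem_exactCovers] at h1 h2
    obtain ⟨T₁, hT₁, rfl⟩ := h1
    obtain ⟨T₂, hT₂, he⟩ := h2
    obtain ⟨a1, a2, a3⟩ := (hL τ).1 hτ
    obtain ⟨b1, b2, b3⟩ := (hL σ).1 hσ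
    refine hne (((isExactCover_insert a1 a2 hT₁).2 v hv).unique
      ⟨Finset.mem_insert_self _ _, a3⟩ ⟨?_, b3⟩)
    rw [← he]
    exact Finset.mem_insert_self _ _

theorem card_exactCovers_of_forced {α : Type*} [DecidableEq α] {Q : Finset α → Prop}
    {U : Finset α} {v : α} (hv : v ∈ U) (τ : Finset α)
    (hτ : ∀ σ, σ = τ ↔ Q σ ∧ σ ⊆ U ∧ v ∈ σ) :
    (exactCovers Q U).card = (exactCovers Q (U \ τ)).card := by
  rw [card_exactCovers_eq_sum hv {τ} (by simpa using hτ), Finset.sum_singleton]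

/-! ### Tiles of the honeycomb -/

/-- The lattice position of a vertex; `A a b` and `B a b` share the position `(a, b)`. -/
def HexVertex.pos : HexVertex → ℕ × ℕ
  | .A a b => (a, b)
  | .B a b => (a, b)

@[simp] theorem HexVertex.pos_A (a b : ℕ) : (HexVertex.A a b).pos = (a, b) := rfl

@[simp] theorem HexVertex.pos_B (a b : ℕ) : (HexVertex.B a b).pos = (a, b) := rfl

/-- The edges of the honeycomb and, if `e` holds, its hexagons. -/
def IsTile (e : Prop) (τ : Finset HexVertex) : Prop :=
  (∃ a b c d, honeycomb.Adj (.A a b) (.B c d) ∧ τ = {.A a b, .B c d}) ∨ (e ∧ ∃ h, τ = hexagon h)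

theorem honeycomb_adj_A_B {a b c d : ℕ} : honeycomb.Adj (.A a b) (.B c d) ↔
    (c = a ∧ d = b) ∨ (c = a + 1 ∧ d = b) ∨ (c = a ∧ d = b + 1) := by
  simp [honeycomb, SimpleGraph.fromRel_adj]

theorem not_honeycomb_adj_A_A {a b c d : ℕ} : ¬ honeycomb.Adj (.A a b) (.A c d) := by
  simp [honeycomb, SimpleGraph.fromRel_adj]

theorem not_honeycomb_adj_B_B {a b c d : ℕ} : ¬ honeycomb.Adj (.B a b) (.B c d) := by
  simp [honeycomb, SimpleGraph.fromRel_adj]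

theorem IsTile.nonempty {e : Prop} {τ : Finset HexVertex} (h : IsTile e τ) : τ.Nonempty := by
  rcases h with ⟨a, b, c, d, -, rfl⟩ | ⟨-, h, rfl⟩
  · exact ⟨_, Finset.mem_insert_self _ _⟩
  · exact ⟨.A h.1 h.2, by simp [hexagon]⟩

/-- The number of ways to tile `U`. -/
noncomputable def numTilings (e : Prop) (U : Finset HexVertex) : ℕ :=
  (exactCovers (IsTile e) U).card

/-- Besides `A a b`, the vertex `B a b` has two upper neighbours, and every hexagon through it
contains one of them. With both absent from `U`, the vertical edge is forced. -/
theorem numTilings_vertical (e : Prop) (U : Finset HexVertex) (a b : ℕ)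
    (hA : .A a b ∈ U) (hB : .B a b ∈ U)
    (h1 : ∀ c, a = c + 1 → .A c b ∉ U) (h2 : ∀ c, b = c + 1 → .A a c ∉ U) :
    numTilings e U = numTilings e (U \ {.A a b, .B a b}) := by
  apply card_exactCovers_of_forced hB
  intro σ
  constructor
  · rintro rfl
    refine ⟨Or.inl ⟨a, b, a, b, honeycomb_adj_A_B.2 (by simp), rfl⟩, ?_, by simp⟩
    intro v hv
    simp only [Finset.mem_insert, Finset.mem_singleton] at hv
    rcases hv with rfl | rfl <;> assumption
  · rintro ⟨⟨c, d, c', d', h, rfl⟩ | ⟨-, ⟨c, d⟩, rfl⟩, hU, hv⟩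
    · simp only [Finset.mem_insert, Finset.mem_singleton, reduceCtorEq, HexVertex.B.injEq,
        false_or] at hv
      obtain ⟨rfl, rfl⟩ := hv
      have hc : .A c d ∈ U := hU (by simp)
      rcases honeycomb_adj_A_B.1 h with ⟨rfl, rfl⟩ | ⟨rfl, rfl⟩ | ⟨rfl, rfl⟩
      · rfl
      · exact absurd hc (h1 c rfl)
      · exact absurd hc (h2 d rfl)
    · exfalso
      simp only [hexagon, Finset.insert_subset_iff, Finset.singleton_subset_iff,
        Finset.mem_insert, Finset.mem_singleton, reduceCtorEq, HexVertex.B.injEq,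
        false_or] at hU hv
      rcases hv with ⟨rfl, rfl⟩ | ⟨rfl, rfl⟩ | ⟨rfl, rfl⟩
      · exact h2 _ rfl hU.1
      · exact h2 _ rfl hU.2.2.2.2.1
      · exact h1 _ rfl hU.1

open Classical in
/-- In a lower set `L` of positions on which `U` is balanced, only vertical edges can be used. -/
theorem numTilings_filter_not_mem (e : Prop) (L : Set (ℕ × ℕ)) (hL : IsLowerSet L)
    (U : Finset HexVertex) (hU : ∀ a b, (a, b) ∈ L → (.A a b ∈ U ↔ .B a b ∈ U)) :
    numTilings e U = numTilings e (U.filter fun v => v.pos ∉ L) := by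
  induction hn : U.card using Nat.strong_induction_on generalizing U with
  | _ n ih =>
    by_cases hex : ∃ s, ∃ a b, a + b = s ∧ (a, b) ∈ L ∧ .B a b ∈ U
    -- Take a + b minimal. An upper neighbour of `B a b` in `U` would lie in `L` at a smaller sum,
    -- and balance would put a B there.
    · obtain ⟨a, b, hs, hab, hB⟩ := Nat.find_spec hex
      have hmin : ∀ c d, c + d < a + b → (c, d) ∈ L → .A c d ∉ U := by
        intro c d hlt hcd hA
        exact Nat.find_min hex (m := c + d) (by omega) ⟨c, d, rfl, hcd, (hU c d hcd).1 hA⟩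
      have hA := (hU a b hab).2 hB
      rw [numTilings_vertical e U a b hA hB, ih _ _ _ _ rfl]
      · congr 1
        ext v
        simp only [Finset.mem_filter, Finset.mem_sdiff, Finset.mem_insert, Finset.mem_singleton]
        constructor
        · rintro ⟨⟨h1, -⟩, h2⟩
          exact ⟨h1, h2⟩
        · rintro ⟨h1, h2⟩
          refine ⟨⟨h1, ?_⟩, h2⟩
          rintro (rfl | rfl) <;> exact h2 hab
      · rw [← hn]
        apply Finset.card_lt_card
        refine Finset.ssubset_iff_subset_ne.2 ⟨Finset.sdiff_subset, fun h => ?_⟩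
        rw [← h] at hB
        simp at hB
      · intro c d hcd
        simp [hU c d hcd]
      · rintro c rfl
        exact hmin c b (by omega) (hL (by simp [Prod.mk_le_mk]) hab)
      · rintro c rfl
        exact hmin a c (by omega) (hL (by simp [Prod.mk_le_mk]) hab)
    · push Not at hex
      congr 1
      ext v
      simp only [Finset.mem_filter, iff_self_and]
      intro hv hvL
      rcases v with ⟨a, b⟩ | ⟨a, b⟩
      · exact hex _ a b rfl hvL ((hU a b hvL).1 hv)
      · exact hex _ a b rfl hvL hv

/-! ### Tilings of a region as lattice paths from source to sink. -/

/-- `V` consists of the vertices at the positions satisfying `P`, which lie between the source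
`s`, where the vertex of type `B` is missing, and the sink `t`, where the vertex of type `A` is
missing. -/
structure IsRegion (P : ℕ → ℕ → Prop) (s t : ℕ × ℕ) (V : Finset HexVertex) : Prop where
  mem_A : ∀ a b, .A a b ∈ V ↔ P a b ∧ (a, b) ≠ t
  mem_B : ∀ a b, .B a b ∈ V ↔ P a b ∧ (a, b) ≠ s
  ge : ∀ a b, P a b → s.1 ≤ a ∧ s.2 ≤ b
  le : ∀ a b, P a b → a ≤ t.1 ∧ b ≤ t.2

/-- The vertices left to be covered by a path that has reached the position `(a, b)`. -/
def pathRest (V : Finset HexVertex) (a b : ℕ) : Finset HexVertex :=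
  V.filter fun v => a ≤ v.pos.1 ∧ b ≤ v.pos.2 ∧ v ≠ .B a b

theorem mem_pathRest_A {V : Finset HexVertex} {a b c d : ℕ} :
    .A c d ∈ pathRest V a b ↔ .A c d ∈ V ∧ a ≤ c ∧ b ≤ d := by
  simp [pathRest]

theorem mem_pathRest_B {V : Finset HexVertex} {a b c d : ℕ} :
    .B c d ∈ pathRest V a b ↔ .B c d ∈ V ∧ a ≤ c ∧ b ≤ d ∧ ¬ (c = a ∧ d = b) := by
  simp [pathRest]

theorem ite_zero_congr {p q : Prop} [Decidable p] [Decidable q] {x y : ℕ} (hpq : p ↔ q)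
    (hxy : q → x = y) : (if p then x else 0) = if q then y else 0 := by
  by_cases hq : q
  · rw [if_pos hq, if_pos (hpq.2 hq), hxy hq]
  · rw [if_neg hq, if_neg (mt hpq.1 hq)]

namespace IsRegion

variable {P : ℕ → ℕ → Prop} {s t : ℕ × ℕ} {V : Finset HexVertex}

theorem pathRest_source (hV : IsRegion P s t V) : pathRest V s.1 s.2 = V := by
  rw [pathRest, Finset.filter_eq_self]
  rintro (⟨a, b⟩ | ⟨a, b⟩) hv
  · have := hV.ge a b ((hV.mem_A a b).1 hv).1
    simpa using this
  · have := hV.ge a b ((hV.mem_B a b).1 hv).1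
    have h2 := ((hV.mem_B a b).1 hv).2
    simp only [ne_eq, Prod.ext_iff] at h2
    simpa [this] using h2

theorem pathRest_sink (hV : IsRegion P s t V) : pathRest V t.1 t.2 = ∅ := by
  rw [pathRest, Finset.filter_eq_empty_iff]
  rintro (⟨a, b⟩ | ⟨a, b⟩) hv
  · have := hV.le a b ((hV.mem_A a b).1 hv).1
    have h2 := ((hV.mem_A a b).1 hv).2
    simp only [ne_eq, Prod.ext_iff] at h2
    simp only [HexVertex.pos_A, ne_eq, reduceCtorEq, not_false_eq_true]
    omega
  · have := hV.le a b ((hV.mem_B a b).1 hv).1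
    simp only [HexVertex.pos_B, ne_eq, HexVertex.B.injEq]
    omega

theorem numTilings_pathRest_sink (hV : IsRegion P s t V) (e : Prop) :
    numTilings e (pathRest V t.1 t.2) = 1 := by
  rw [hV.pathRest_sink]
  exact card_exactCovers_empty fun _ h => h.nonempty

/-- After removing the vertices covered by a step from `(a, b)` to `(c, d)`, the positions that
are not reachable from `(c, d)` are covered by vertical edges. -/
theorem numTilings_pathRest_sdiff (hV : IsRegion P s t V) (e : Prop) {a b c d : ℕ}
    (hac : a ≤ c) (hbd : b ≤ d) (hab : P a b) (hcd : P c d) (τ : Finset HexVertex)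
    (h1 : .A c d ∉ τ) (h2 : .B c d ∈ τ) (h3 : .A a b ∈ τ)
    (h4 : ∀ v ∈ τ, v.pos ≠ (c, d) → v.pos.1 < c ∨ v.pos.2 < d)
    (h5 : ∀ x y, (x, y) ≠ (a, b) → (x, y) ≠ (c, d) → (.A x y ∈ τ ↔ .B x y ∈ τ)) :
    numTilings e (pathRest V a b \ τ) = numTilings e (pathRest V c d) := by
  have ht := hV.le c d hcd
  rw [numTilings_filter_not_mem e {q | ¬ (c, d) ≤ q}]
  · congr 1
    ext v
    rcases v with ⟨x, y⟩ | ⟨x, y⟩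
    · have h4 := h4 (.A x y)
      simp only [Finset.mem_filter, Finset.mem_sdiff, mem_pathRest_A, HexVertex.pos_A,
        Set.mem_ofPred_eq, not_not, Prod.mk_le_mk, ne_eq, Prod.mk.injEq] at h4 ⊢
      constructor
      · tauto
      · rintro ⟨hv, hx, hy⟩
        refine ⟨⟨⟨hv, by omega, by omega⟩, fun hτ => ?_⟩, hx, hy⟩
        by_cases hq : x = c ∧ y = d
        · obtain ⟨rfl, rfl⟩ := hq
          exact h1 hτ
        · have := h4 hτ hq
          omega
    · have h4 := h4 (.B x y)
      simp only [Finset.mem_filter, Finset.mem_sdiff, mem_pathRest_B, HexVertex.pos_B,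
        Set.mem_ofPred_eq, not_not, Prod.mk_le_mk, ne_eq, Prod.mk.injEq] at h4 ⊢
      constructor
      · rintro ⟨⟨⟨hv, -⟩, hτ⟩, hx, hy⟩
        refine ⟨hv, hx, hy, ?_⟩
        rintro ⟨rfl, rfl⟩
        exact hτ h2
      · rintro ⟨hv, hx, hy, hq⟩
        refine ⟨⟨⟨hv, by omega, by omega, ?_⟩, fun hτ => ?_⟩, hx, hy⟩
        · omega
        · have := h4 hτ hq
          omega
  · intro p q hqp hp hq
    exact hp (hq.trans hqp)
  · intro x y hxy
    simp only [Set.mem_ofPred_eq, Prod.mk_le_mk] at hxy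
    simp only [Finset.mem_sdiff, mem_pathRest_A, mem_pathRest_B, hV.mem_A, hV.mem_B]
    -- At (a, b) the B was already gone and `τ` takes the A; elsewhere outside the new cone `τ`
    -- removes both vertices or neither.
    by_cases hq : (x, y) = (a, b)
    · simp only [Prod.mk.injEq] at hq
      obtain ⟨rfl, rfl⟩ := hq
      simp [h3]
    · have := h5 x y hq (by rintro h; simp only [Prod.mk.injEq] at h; omega)
      rw [this]
      have ht' : (x, y) ≠ t := by
        rintro rfl
        exact hxy ht
      have hs : a ≤ x → b ≤ y → (x, y) ≠ s := by
        rintro hx hy rfl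
        have := hV.ge a b hab
        simp only [Prod.mk.injEq] at hq this
        omega
      simp only [Prod.mk.injEq] at hq
      tauto

theorem edge_subset_pathRest_iff (hV : IsRegion P s t V) {a b c d : ℕ} (hab : P a b)
    (ht : (a, b) ≠ t) (hac : a ≤ c) (hbd : b ≤ d) (hne : ¬ (c = a ∧ d = b)) :
    ({.A a b, .B c d} : Finset HexVertex) ⊆ pathRest V a b ↔ P c d := by
  simp only [Finset.insert_subset_iff, Finset.singleton_subset_iff, mem_pathRest_A,
    mem_pathRest_B, hV.mem_A, hV.mem_B]
  have := hV.ge a b hab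
  have hs : (c, d) ≠ s := by
    rintro rfl
    simp only at this
    omega
  tauto

/-- All three further positions are needed: at an inner corner the opposite one can lie in the
region while the hexagon does not. -/
theorem hexagon_subset_pathRest_iff (hV : IsRegion P s t V) {a b : ℕ} (hab : P a b)
    (ht : (a, b) ≠ t) :
    hexagon (a, b) ⊆ pathRest V a b ↔ P (a + 1) b ∧ P a (b + 1) ∧ P (a + 1) (b + 1) := by
  simp only [hexagon, Finset.insert_subset_iff, Finset.singleton_subset_iff, mem_pathRest_A,
    mem_pathRest_B, hV.mem_A, hV.mem_B]
  have h1 := hV.ge a b hab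
  have h2 := hV.le (a + 1) (b + 1)
  have hs1 : (a + 1, b) ≠ s := by
    rintro rfl
    simp only at h1
    omega
  have hs2 : (a, b + 1) ≠ s := by
    rintro rfl
    simp only at h1
    omega
  have hs3 : (a + 1, b + 1) ≠ s := by
    rintro rfl
    simp only at h1
    omega
  constructor
  · tauto
  · rintro ⟨p1, p2, p3⟩
    have ht1 : (a + 1, b) ≠ t := by
      rintro rfl
      have := h2 p3
      simp only at this
      omega
    have ht2 : (a, b + 1) ≠ t := by
      rintro rfl
      have := h2 p3
      simp only at this
      omega
    refine ⟨⟨⟨hab, ht⟩, ?_⟩, ⟨⟨p2, hs2⟩, ?_⟩, ⟨⟨p2, ht2⟩, ?_⟩, ⟨⟨p3, hs3⟩, ?_⟩, ⟨⟨p1, ht1⟩, ?_⟩,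
      ⟨p1, hs1⟩, ?_⟩ <;> omega

/-- The vertical edge is excluded because `B a b` is already used, and the other two hexagons
through `A a b` have their top vertex outside `pathRest V a b`. -/
theorem isTile_mem_A_iff (e : Prop) (V : Finset HexVertex) (a b : ℕ) (τ : Finset HexVertex) :
    IsTile e τ ∧ τ ⊆ pathRest V a b ∧ .A a b ∈ τ ↔
      τ ⊆ pathRest V a b ∧
        (τ = {.A a b, .B (a + 1) b} ∨ τ = {.A a b, .B a (b + 1)} ∨ (e ∧ τ = hexagon (a, b))) := by
  constructor
  · rintro ⟨⟨x, y, c, d, h, rfl⟩ | ⟨he, ⟨c, d⟩, rfl⟩, hU, hv⟩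
    · refine ⟨hU, ?_⟩
      simp only [Finset.mem_insert, Finset.mem_singleton, reduceCtorEq, HexVertex.A.injEq,
        or_false] at hv
      obtain ⟨rfl, rfl⟩ := hv
      rcases honeycomb_adj_A_B.1 h with ⟨rfl, rfl⟩ | ⟨rfl, rfl⟩ | ⟨rfl, rfl⟩
      · exfalso
        have : HexVertex.B c d ∈ pathRest V c d := hU (by simp)
        simp [mem_pathRest_B] at this
      · simp
      · simp
    · refine ⟨hU, ?_⟩
      have h1 := hU (show HexVertex.A c d ∈ hexagon (c, d) by simp [hexagon])
      rw [mem_pathRest_A] at h1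
      simp only [hexagon, Finset.mem_insert, Finset.mem_singleton, reduceCtorEq,
        HexVertex.A.injEq, or_false, false_or] at hv
      obtain ⟨rfl, rfl⟩ : c = a ∧ d = b := by omega
      simp [he]
  · rintro ⟨hU, rfl | rfl | ⟨he, rfl⟩⟩
    · exact ⟨Or.inl ⟨_, _, _, _, honeycomb_adj_A_B.2 (by simp), rfl⟩, hU, by simp⟩
    · exact ⟨Or.inl ⟨_, _, _, _, honeycomb_adj_A_B.2 (by simp), rfl⟩, hU, by simp⟩
    · exact ⟨Or.inr ⟨he, _, rfl⟩, hU, by simp [hexagon]⟩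

open Classical in
/-- Tilings of a region are counted like lattice paths from its source to its sink: a path takes
a unit step along an edge, or a diagonal step across a hexagon. -/
theorem numTilings_pathRest (hV : IsRegion P s t V) (e : Prop) {a b : ℕ} (hab : P a b)
    (ht : (a, b) ≠ t) :
    numTilings e (pathRest V a b) =
      (if P (a + 1) b then numTilings e (pathRest V (a + 1) b) else 0) +
      (if P a (b + 1) then numTilings e (pathRest V a (b + 1)) else 0) +
      (if e ∧ P (a + 1) b ∧ P a (b + 1) ∧ P (a + 1) (b + 1) then
        numTilings e (pathRest V (a + 1) (b + 1)) else 0) := by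
  have hv : .A a b ∈ pathRest V a b := by
    simp [mem_pathRest_A, hV.mem_A, hab, ht]
  have n1 : ({.A a b, .B (a + 1) b} : Finset HexVertex) ≠ hexagon (a, b) := fun h => by
    have : HexVertex.B a (b + 1) ∈ hexagon (a, b) := by simp [hexagon]
    rw [← h] at this
    simp at this
  have n2 : ({.A a b, .B a (b + 1)} : Finset HexVertex) ≠ hexagon (a, b) := fun h => by
    have : HexVertex.B (a + 1) b ∈ hexagon (a, b) := by simp [hexagon]
    rw [← h] at this
    simp at this
  have n3 : ({.A a b, .B (a + 1) b} : Finset HexVertex) ≠ {.A a b, .B a (b + 1)} := fun h => by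
    have : HexVertex.B a (b + 1) ∈ ({.A a b, .B a (b + 1)} : Finset HexVertex) := by simp
    rw [← h] at this
    simp at this
  have key := card_exactCovers_eq_sum (Q := IsTile e) hv
    (({{.A a b, .B (a + 1) b}, {.A a b, .B a (b + 1)}, hexagon (a, b)} :
      Finset (Finset HexVertex)).filter
      fun τ => τ ⊆ pathRest V a b ∧ (τ = hexagon (a, b) → e)) (by
        intro τ
        rw [isTile_mem_A_iff]
        simp only [Finset.mem_filter, Finset.mem_insert, Finset.mem_singleton]
        constructor
        · rintro ⟨rfl | rfl | rfl, h3, h4⟩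
          · exact ⟨h3, by simp⟩
          · exact ⟨h3, by simp⟩
          · exact ⟨h3, by simp [h4]⟩
        · rintro ⟨h3, rfl | rfl | ⟨he, rfl⟩⟩
          · exact ⟨by simp, h3, fun h => absurd h n1⟩
          · exact ⟨by simp, h3, fun h => absurd h n2⟩
          · exact ⟨by simp, h3, fun _ => he⟩)
  rw [Finset.sum_filter, Finset.sum_insert (by simp [n1, n3]), Finset.sum_insert (by simp [n2]),
    Finset.sum_singleton] at key
  rw [numTilings, key, ← add_assoc]
  congr 1
  · congr 1
    · refine ite_zero_congr ?_ fun h => ?_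
      · rw [hV.edge_subset_pathRest_iff hab ht (by omega) (by omega) (by omega)]
        simp [n1]
      · refine hV.numTilings_pathRest_sdiff e (by omega) (by omega) hab h _ (by simp) (by simp)
          (by simp) ?_ ?_
        · simp
        · intro x y h1 h2
          simp only [Prod.mk.injEq, ne_eq] at h1 h2
          simp [h1, h2]
    · refine ite_zero_congr ?_ fun h => ?_
      · rw [hV.edge_subset_pathRest_iff hab ht (by omega) (by omega) (by omega)]
        simp [n2]
      · refine hV.numTilings_pathRest_sdiff e (by omega) (by omega) hab h _ (by simp) (by simp)
          (by simp) ?_ ?_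
        · simp
        · intro x y h1 h2
          simp only [Prod.mk.injEq, ne_eq] at h1 h2
          simp [h1, h2]
  · refine ite_zero_congr ?_ fun h => ?_
    · rw [hV.hexagon_subset_pathRest_iff hab ht]
      tauto
    · refine hV.numTilings_pathRest_sdiff e (by omega) (by omega) hab h.2.2.2 _
        (by simp [hexagon]) (by simp [hexagon]) (by simp [hexagon]) ?_ ?_
      · simp [hexagon]
      · intro x y h1 h2
        simp only [Prod.mk.injEq, ne_eq] at h1 h2
        simp only [hexagon, Finset.mem_insert, Finset.mem_singleton, HexVertex.A.injEq,
          HexVertex.B.injEq, reduceCtorEq, false_or, or_false]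
        omega

end IsRegion

open Classical in
/-- The tilings of the part of an L-shaped region below and to the right of the inner corner. -/
theorem IsRegion.numTilings_pathRest_rectangle {P : ℕ → ℕ → Prop} {s : ℕ × ℕ} {N M : ℕ}
    {V : Finset HexVertex} (hV : IsRegion P s (N, M) V) (e : Prop) (c : ℕ)
    (hP : ∀ a b, c ≤ a → s.2 ≤ b → a ≤ N → b ≤ M → P a b) (n m : ℕ) (hn : c + n ≤ N)
    (hm : s.2 + m ≤ M) :
    numTilings e (pathRest V (N - n) (M - m)) = delannoy (1 + if e then 1 else 0) n m := by
  induction hk : n + m using Nat.strong_induction_on generalizing n m with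
  | _ k ih =>
    have hle := hV.le
    by_cases h0 : n = 0 ∧ m = 0
    · obtain ⟨rfl, rfl⟩ := h0
      simpa using hV.numTilings_pathRest_sink e
    · rw [hV.numTilings_pathRest e (hP _ _ (by omega) (by omega) (by omega) (by omega))
        (by simp only [ne_eq, Prod.mk.injEq]; omega)]
      rcases n with _ | n
      · obtain ⟨m, rfl⟩ := Nat.exists_eq_succ_of_ne_zero (show m ≠ 0 by omega)
        have h1 : ¬ P (N - 0 + 1) (M - (m + 1)) := fun h => by have := hle _ _ h; omega
        have h2 : P (N - 0) (M - (m + 1) + 1) :=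
          hP _ _ (by omega) (by omega) (by omega) (by omega)
        have e1 : M - (m + 1) + 1 = M - m := by omega
        simp only [h1, h2, if_true, if_false, false_and, and_false]
        rw [e1, ih _ _ 0 m hn (by omega) rfl]
        · simp
        · omega
      · rcases m with _ | m
        · have h1 : ¬ P (N - (n + 1)) (M - 0 + 1) := fun h => by have := hle _ _ h; omega
          have h2 : P (N - (n + 1) + 1) (M - 0) :=
            hP _ _ (by omega) (by omega) (by omega) (by omega)
          have e1 : N - (n + 1) + 1 = N - n := by omega
          simp only [h1, h2, if_true, if_false, false_and, and_false]
          rw [e1, ih _ _ n 0 (by omega) hm rfl]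
          · simp
          · omega
        · have h1 : P (N - (n + 1)) (M - (m + 1) + 1) :=
            hP _ _ (by omega) (by omega) (by omega) (by omega)
          have h2 : P (N - (n + 1) + 1) (M - (m + 1)) :=
            hP _ _ (by omega) (by omega) (by omega) (by omega)
          have h3 : P (N - (n + 1) + 1) (M - (m + 1) + 1) :=
            hP _ _ (by omega) (by omega) (by omega) (by omega)
          have e1 : N - (n + 1) + 1 = N - n := by omega
          have e2 : M - (m + 1) + 1 = M - m := by omega
          simp only [h1, h2, h3, if_true, and_true]
          rw [e1, e2, ih _ _ n (m + 1) (by omega) (by omega) rfl,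
            ih _ _ (n + 1) m (by omega) (by omega) rfl, ih _ _ n m (by omega) (by omega) rfl,
            delannoy_succ_succ]
          · split_ifs <;> simp
          all_goals omega

/-! ### The ribbon as an L-shaped region. -/

/-- The positions of the ribbon with `n₁, m₁ > 0`. -/
def ribbonPos (n₁ n₂ m₁ m₂ a b : ℕ) : Prop :=
  a ≤ n₂ + n₁ ∧ b ≤ m₁ + m₂ ∧ (a < n₂ → b ≤ m₁)

open Classical in
theorem IsRegion.numTilings_ribbon {n₁ n₂ m₁ m₂ : ℕ} (hm : 0 < m₁) {V : Finset HexVertex}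
    (hV : IsRegion (ribbonPos n₁ n₂ m₁ m₂) (0, 0) (n₂ + n₁, m₁ + m₂) V) (e : Prop) (x : ℕ)
    (hx : x = 1 + if e then 1 else 0) :
    numTilings e V =
      ∑ k ∈ Finset.Icc 0 (min n₁ m₁), delannoy x (n₂ + k) (m₁ - k) * delannoy x (m₂ + k) (n₁ - k) +
      (if e then 1 else 0) * ∑ k ∈ Finset.Icc 1 (min n₁ m₁),
        delannoy x (n₂ + k - 1) (m₁ - k) * delannoy x (m₂ + k - 1) (n₁ - k) := by
  subst hx
  set ε := if e then 1 else 0 with hε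
  have hrect := fun n m h1 h2 => hV.numTilings_pathRest_rectangle e n₂
    (fun a b h1 h2 h3 h4 => ⟨h3, h4, by omega⟩) n m h1 h2
  -- Cutting off at b ≤ m₁ loses nothing before the antidiagonal: a point there with b = m₁ has a <
  -- n₂, so a step up in b leaves the ribbon, and so does the hexagon, even when its far end is (n₂,
  -- m₁ + 1).
  set F : ℕ → ℕ → ℕ := fun a b =>
    if a ≤ n₂ + n₁ ∧ b ≤ m₁ then numTilings e (pathRest V a b) else 0 with hF
  have hrec : ∀ a b, a + b < n₂ + m₁ →
      F a b = F (a + 1) b + F a (b + 1) + ε * F (a + 1) (b + 1) := by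
    intro a b hab
    by_cases h : a ≤ n₂ + n₁ ∧ b ≤ m₁
    · simp only [hF]
      rw [if_pos h, hV.numTilings_pathRest e ⟨h.1, by omega, by omega⟩
        (by simp only [ne_eq, Prod.mk.injEq]; omega)]
      have c1 : ribbonPos n₁ n₂ m₁ m₂ (a + 1) b ↔ a + 1 ≤ n₂ + n₁ ∧ b ≤ m₁ := by
        unfold ribbonPos; omega
      have c2 : ribbonPos n₁ n₂ m₁ m₂ a (b + 1) ↔ a ≤ n₂ + n₁ ∧ b + 1 ≤ m₁ := by
        unfold ribbonPos; omega
      have c3 : (ribbonPos n₁ n₂ m₁ m₂ (a + 1) b ∧ ribbonPos n₁ n₂ m₁ m₂ a (b + 1) ∧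
          ribbonPos n₁ n₂ m₁ m₂ (a + 1) (b + 1)) ↔ a + 1 ≤ n₂ + n₁ ∧ b + 1 ≤ m₁ := by
        unfold ribbonPos; omega
      simp only [c3]
      simp only [c1, c2]
      congr 1
      by_cases he : e <;> simp [hε, he]
    · simp only [hF]
      rw [if_neg h, if_neg (by omega), if_neg (by omega), if_neg (by omega)]
      simp
  have h0 : numTilings e V = F 0 0 := by
    simp only [hF]
    rw [if_pos (by omega)]
    exact congrArg _ hV.pathRest_source.symm
  -- Since m₁ > 0 the subtraction is exact, and the antidiagonal d + 1 passes through the inner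
  -- corner (n₂, m₁).
  rw [h0, delannoy_split ε (n₂ + m₁) F hrec (n₂ + m₁ - 1) (by omega)]
  congr 1
  · rw [show n₂ + m₁ - 1 + 1 = n₂ + m₁ by omega]
    symm
    apply Finset.sum_of_injOn (fun k => (n₂ + k, m₁ - k))
    · intro k _ l _ h
      simp only [Prod.mk.injEq] at h
      omega
    · intro k hk
      simp only [Finset.coe_Icc, Set.mem_Icc, Finset.mem_coe,
        Finset.HasAntidiagonal.mem_antidiagonal] at hk ⊢
      omega
    -- Points not of the form (n₂ + k, m₁ - k) with k in range have b > m₁ or a > n₂ + n₁, where `F`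
    -- vanishes.
    · rintro ⟨a, b⟩ hq hn
      rw [Finset.HasAntidiagonal.mem_antidiagonal] at hq
      simp only [hF]
      rw [if_neg, mul_zero]
      rintro ⟨h1, h2⟩
      simp only at hq
      refine hn ⟨m₁ - b, ?_, ?_⟩
      · simp only [Finset.coe_Icc, Set.mem_Icc]
        omega
      · simp only [Prod.mk.injEq]
        omega
    · intro k hk
      simp only [Finset.mem_Icc] at hk
      simp only [hF]
      rw [if_pos (by omega)]
      congr 1
      -- From (n₂ + k, m₁ - k) to the sink there remains a full rectangle, as a ≥ n₂.
      rw [delannoy_comm, ← hrect (n₁ - k) (m₂ + k) (by omega) (by simp only; omega)]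
      congr 2 <;> omega
  · congr 1
    symm
    apply Finset.sum_of_injOn (fun k => (n₂ + k - 1, m₁ - k))
    · intro k hk l hl h
      simp only [Finset.coe_Icc, Set.mem_Icc, Prod.mk.injEq] at hk hl h
      omega
    · intro k hk
      simp only [Finset.coe_Icc, Set.mem_Icc, Finset.mem_coe,
        Finset.HasAntidiagonal.mem_antidiagonal] at hk ⊢
      omega
    · rintro ⟨a, b⟩ hq hn
      rw [Finset.HasAntidiagonal.mem_antidiagonal] at hq
      simp only [hF]
      rw [if_neg, mul_zero]
      rintro ⟨h1, h2⟩
      simp only at hq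
      refine hn ⟨m₁ - b, ?_, ?_⟩
      · simp only [Finset.coe_Icc, Set.mem_Icc]
        omega
      · simp only [Prod.mk.injEq]
        omega
    · intro k hk
      simp only [Finset.mem_Icc] at hk
      simp only [hF]
      rw [if_pos (by omega)]
      congr 1
      -- The jump lands at (n₂ + k, m₁ - k + 1), so the remaining height is one less than for a
      -- visit.
      rw [delannoy_comm, ← hrect (n₁ - k) (m₂ + k - 1) (by omega) (by simp only; omega)]
      congr 2 <;> omega

/-! ### Clar covers as tilings -/

theorem honeycomb_adj_B_A {a b c d : ℕ} : honeycomb.Adj (.B c d) (.A a b) ↔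
    (c = a ∧ d = b) ∨ (c = a + 1 ∧ d = b) ∨ (c = a ∧ d = b + 1) := by
  rw [SimpleGraph.adj_comm, honeycomb_adj_A_B]

theorem A_mem_hexagon {x y a b : ℕ} : .A x y ∈ hexagon (a, b) ↔
    (x = a ∧ y = b) ∨ (x = a ∧ y = b + 1) ∨ (x = a + 1 ∧ y = b) := by
  simp [hexagon]

theorem B_mem_hexagon {x y a b : ℕ} : .B x y ∈ hexagon (a, b) ↔
    (x = a ∧ y = b + 1) ∨ (x = a + 1 ∧ y = b + 1) ∨ (x = a + 1 ∧ y = b) := by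
  simp [hexagon]

theorem card_hexagon (h : ℕ × ℕ) : (hexagon h).card = 6 := by
  simp [hexagon]

theorem commonNeighbor_cases {a b a' b' c d : ℕ} (h : honeycomb.Adj (.A a b) (.B c d))
    (h' : honeycomb.Adj (.A a' b') (.B c d)) (hne : ¬ (a = a' ∧ b = b')) :
    (a = c ∧ b = d ∧ a' + 1 = c ∧ b' = d) ∨ (a = c ∧ b = d ∧ a' = c ∧ b' + 1 = d) ∨
    (a + 1 = c ∧ b = d ∧ a' = c ∧ b' = d) ∨ (a + 1 = c ∧ b = d ∧ a' = c ∧ b' + 1 = d) ∨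
    (a = c ∧ b + 1 = d ∧ a' = c ∧ b' = d) ∨ (a = c ∧ b + 1 = d ∧ a' + 1 = c ∧ b' = d) := by
  rw [honeycomb_adj_A_B] at h h'
  rcases h with h | h | h <;> rcases h' with h' | h' | h' <;>
  first
  | exfalso; omega
  | exact Or.inl (by omega)
  | exact Or.inr (Or.inl (by omega))
  | exact Or.inr (Or.inr (Or.inl (by omega)))
  | exact Or.inr (Or.inr (Or.inr (Or.inl (by omega))))
  | exact Or.inr (Or.inr (Or.inr (Or.inr (Or.inl (by omega)))))
  | exact Or.inr (Or.inr (Or.inr (Or.inr (Or.inr (by omega)))))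

/-- A finite check: each B on the cycle is passed in one of six ways, and the only choices at the
three B's that close up without repetition run around a cell. -/
theorem exists_hexagon_of_alternating_sixCycle {a₀ b₀ c₁ d₁ a₂ b₂ c₃ d₃ a₄ b₄ c₅ d₅ : ℕ}
    (h₀ : honeycomb.Adj (.A a₀ b₀) (.B c₁ d₁)) (h₁ : honeycomb.Adj (.A a₂ b₂) (.B c₁ d₁))
    (h₂ : honeycomb.Adj (.A a₂ b₂) (.B c₃ d₃)) (h₃ : honeycomb.Adj (.A a₄ b₄) (.B c₃ d₃))
    (h₄ : honeycomb.Adj (.A a₄ b₄) (.B c₅ d₅)) (h₅ : honeycomb.Adj (.A a₀ b₀) (.B c₅ d₅))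
    (n₀₂ : ¬ (a₀ = a₂ ∧ b₀ = b₂)) (n₂₄ : ¬ (a₂ = a₄ ∧ b₂ = b₄)) (n₀₄ : ¬ (a₀ = a₄ ∧ b₀ = b₄))
    (n₁₃ : ¬ (c₁ = c₃ ∧ d₁ = d₃)) (n₃₅ : ¬ (c₃ = c₅ ∧ d₃ = d₅)) (n₁₅ : ¬ (c₁ = c₅ ∧ d₁ = d₅)) :
    ∃ h, .A a₀ b₀ ∈ hexagon h ∧ .B c₁ d₁ ∈ hexagon h ∧ .A a₂ b₂ ∈ hexagon h ∧
      .B c₃ d₃ ∈ hexagon h ∧ .A a₄ b₄ ∈ hexagon h ∧ .B c₅ d₅ ∈ hexagon h := by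
  have k₁ := commonNeighbor_cases h₀ h₁ n₀₂
  have k₃ := commonNeighbor_cases h₂ h₃ n₂₄
  have k₅ := commonNeighbor_cases h₅ h₄ n₀₄
  clear h₀ h₁ h₂ h₃ h₄ h₅ n₀₂ n₂₄ n₀₄
  -- The A-vertices of the cell (a, b) are at (a, b), (a, b + 1) and (a + 1, b), so coordinatewise
  -- minima recover the cell.
  refine ⟨(min a₀ (min a₂ a₄), min b₀ (min b₂ b₄)), ?_⟩
  simp only [A_mem_hexagon, B_mem_hexagon]
  rcases k₁ with k₁ | k₁ | k₁ | k₁ | k₁ | k₁ <;> rcases k₃ with k₃ | k₃ | k₃ | k₃ | k₃ | k₃ <;>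
  first
  | exfalso; clear k₅; omega
  | rcases k₅ with k₅ | k₅ | k₅ | k₅ | k₅ | k₅ <;>
    first
    | exfalso; omega
    | clear n₁₃ n₃₅ n₁₅; refine ⟨?_, ?_, ?_, ?_, ?_, ?_⟩ <;> omega

theorem exists_hexagon_of_sixCycle (v : Fin 6 → HexVertex) (hv : Function.Injective v)
    (hadj : ∀ i, honeycomb.Adj (v i) (v (i + 1))) : ∃ h, ∀ i, v i ∈ hexagon h := by
  have h0 : honeycomb.Adj (v 0) (v 1) := hadj 0
  have h1 : honeycomb.Adj (v 1) (v 2) := hadj 1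
  have h2 : honeycomb.Adj (v 2) (v 3) := hadj 2
  have h3 : honeycomb.Adj (v 3) (v 4) := hadj 3
  have h4 : honeycomb.Adj (v 4) (v 5) := hadj 4
  have h5 : honeycomb.Adj (v 5) (v 0) := hadj 5
  have n02 : v 0 ≠ v 2 := hv.ne (by decide)
  have n24 : v 2 ≠ v 4 := hv.ne (by decide)
  have n04 : v 0 ≠ v 4 := hv.ne (by decide)
  have n13 : v 1 ≠ v 3 := hv.ne (by decide)
  have n35 : v 3 ≠ v 5 := hv.ne (by decide)
  have n15 : v 1 ≠ v 5 := hv.ne (by decide)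
  suffices h : ∃ h, v 0 ∈ hexagon h ∧ v 1 ∈ hexagon h ∧ v 2 ∈ hexagon h ∧ v 3 ∈ hexagon h ∧
      v 4 ∈ hexagon h ∧ v 5 ∈ hexagon h by
    obtain ⟨h, hh⟩ := h
    refine ⟨h, fun i => ?_⟩
    fin_cases i
    exacts [hh.1, hh.2.1, hh.2.2.1, hh.2.2.2.1, hh.2.2.2.2.1, hh.2.2.2.2.2]
  generalize v 0 = v0 at *
  generalize v 1 = v1 at *
  generalize v 2 = v2 at *
  generalize v 3 = v3 at *
  generalize v 4 = v4 at *
  generalize v 5 = v5 at *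
  have alt : ∀ {u w : HexVertex}, honeycomb.Adj u w →
      (∃ a b c d, u = .A a b ∧ w = .B c d) ∨ (∃ a b c d, u = .B a b ∧ w = .A c d) := by
    rintro (⟨a, b⟩ | ⟨a, b⟩) (⟨c, d⟩ | ⟨c, d⟩) h
    · exact absurd h not_honeycomb_adj_A_A
    · exact Or.inl ⟨a, b, c, d, rfl, rfl⟩
    · exact Or.inr ⟨a, b, c, d, rfl, rfl⟩
    · exact absurd h not_honeycomb_adj_B_B
  rcases alt h0 with ⟨a0, b0, a1, b1, rfl, rfl⟩ | ⟨a0, b0, a1, b1, rfl, rfl⟩ <;>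
  rcases alt h2 with ⟨a2, b2, a3, b3, rfl, rfl⟩ | ⟨a2, b2, a3, b3, rfl, rfl⟩ <;>
  rcases alt h4 with ⟨a4, b4, a5, b5, rfl, rfl⟩ | ⟨a4, b4, a5, b5, rfl, rfl⟩ <;>
  try simp only [not_honeycomb_adj_A_A, not_honeycomb_adj_B_B] at h1 h3 h5
  · simp only [ne_eq, HexVertex.A.injEq, HexVertex.B.injEq] at n02 n24 n04 n13 n35 n15
    obtain ⟨h, hh⟩ := exists_hexagon_of_alternating_sixCycle h0 h1.symm h2 h3.symm h4 h5.symm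
      n02 n24 n04 n13 n35 n15
    exact ⟨h, hh⟩
  -- Here the cycle starts at a B; it is rotated by one place.
  · simp only [ne_eq, HexVertex.A.injEq, HexVertex.B.injEq] at n02 n24 n04 n13 n35 n15
    obtain ⟨h, hh⟩ := exists_hexagon_of_alternating_sixCycle h1 h2.symm h3 h4.symm h5 h0.symm
      n13 n35 n15 n24 (fun h => n04 ⟨h.1.symm, h.2.symm⟩) (fun h => n02 ⟨h.1.symm, h.2.symm⟩)
    exact ⟨h, hh.2.2.2.2.2, hh.1, hh.2.1, hh.2.2.1, hh.2.2.2.1, hh.2.2.2.2.1⟩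

/-- The honeycomb restricted to an edge. -/
theorem induce_edge_iso {u w : HexVertex} (h : honeycomb.Adj u w) :
    Nonempty (honeycomb.induce {x | x ∈ ({u, w} : Finset HexVertex)} ≃g
      SimpleGraph.completeGraph (Fin 2)) := by
  have hne : u ≠ w := h.ne
  have htop : honeycomb.induce {x | x ∈ ({u, w} : Finset HexVertex)} = ⊤ := by
    ext ⟨x, hx⟩ ⟨y, hy⟩
    simp only [Finset.mem_insert, Finset.mem_singleton, Set.mem_ofPred_eq] at hx hy
    simp only [SimpleGraph.comap_adj, Function.Embedding.subtype_apply, SimpleGraph.top_adj, ne_eq,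
      Subtype.mk.injEq]
    rcases hx with rfl | rfl <;> rcases hy with rfl | rfl <;> simp [h, h.symm, hne, hne.symm]
  have hcard : Fintype.card ({u, w} : Finset HexVertex) = Fintype.card (Fin 2) := by
    simp [Finset.card_pair hne]
  rw [htop]
  exact ⟨SimpleGraph.Iso.completeGraph (Fintype.equivOfCardEq hcard)⟩

/-- The honeycomb restricted to a hexagon. -/
theorem induce_hexagon_iso (h : ℕ × ℕ) :
    Nonempty (honeycomb.induce {x | x ∈ hexagon h} ≃g SimpleGraph.cycleGraph 6) := by
  obtain ⟨a, b⟩ := h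
  let f : Fin 6 → HexVertex := ![.A a b, .B a (b + 1), .A a (b + 1), .B (a + 1) (b + 1),
    .A (a + 1) b, .B (a + 1) b]
  have hf : ∀ i, f i ∈ hexagon (a, b) := by
    intro i
    fin_cases i <;> simp [f, hexagon]
  have hinj : Function.Injective f := by
    intro i j hij
    fin_cases i <;> fin_cases j <;> simp [f] at hij ⊢
  let g : Fin 6 → {x // x ∈ hexagon (a, b)} := fun i => ⟨f i, hf i⟩
  have hg : Function.Bijective g := by
    rw [Fintype.bijective_iff_injective_and_card]
    refine ⟨fun i j hij => hinj (congrArg Subtype.val hij), ?_⟩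
    simp [card_hexagon]
  have hadj : ∀ i j, honeycomb.Adj (f i) (f j) ↔ (SimpleGraph.cycleGraph 6).Adj i j := by
    intro i j
    have hc : (SimpleGraph.cycleGraph 6).Adj i j ↔ i - j = 1 ∨ j - i = 1 :=
      SimpleGraph.cycleGraph_adj
    rw [hc]
    fin_cases i <;> fin_cases j <;>
      simp [f, honeycomb_adj_A_B, honeycomb_adj_B_A, not_honeycomb_adj_A_A,
        not_honeycomb_adj_B_B] <;> decide
  exact ⟨(⟨Equiv.ofBijective g hg, fun {i j} => hadj i j⟩ :
    SimpleGraph.cycleGraph 6 ≃g honeycomb.induce {x | x ∈ hexagon (a, b)}).symm⟩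

/-- The edge counts agree. This shows that a component of a cover has every honeycomb edge between
its vertices. -/
theorem SimpleGraph.eq_of_le_of_iso {α β : Type*} [Finite α] {X Y : SimpleGraph α}
    {K : SimpleGraph β} (hle : X ≤ Y) (f : X ≃g K) (g : Y ≃g K) : X = Y := by
  classical
  have := Fintype.ofFinite α
  rw [← SimpleGraph.edgeFinset_inj]
  refine Finset.eq_of_subset_of_card_le (SimpleGraph.edgeFinset_mono hle) ?_
  exact (SimpleGraph.Iso.card_edgeFinset_eq (f.trans g.symm)).ge

/-! ### The bijection between covers and tilings. -/

section CoverTiling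

variable {p : HexVertex → Prop}

/-- A spanning subgraph all of whose components are `K₂` or, if `e` holds, hexagons. -/
def IsCover {V : Type*} (e : Prop) (G H : SimpleGraph V) : Prop :=
  H ≤ G ∧ ∀ c : H.ConnectedComponent, IsDoubleBond c ∨ (e ∧ IsSextet c)

/-- The graph whose edges are the honeycomb edges inside the members of `T`. -/
def tilingGraph (p : HexVertex → Prop) (T : Finset (Finset HexVertex)) :
    SimpleGraph {v // p v} where
  Adj u v := honeycomb.Adj u.1 v.1 ∧ ∃ τ ∈ T, u.1 ∈ τ ∧ v.1 ∈ τ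
  symm := ⟨fun _ _ ⟨h, τ, hτ, hu, hv⟩ => ⟨h.symm, τ, hτ, hv, hu⟩⟩
  loopless := ⟨fun _ h => h.1.ne rfl⟩

theorem IsTile.iso {e : Prop} {τ : Finset HexVertex} (h : IsTile e τ) :
    Nonempty (honeycomb.induce {x | x ∈ τ} ≃g SimpleGraph.completeGraph (Fin 2)) ∨
      (e ∧ Nonempty (honeycomb.induce {x | x ∈ τ} ≃g SimpleGraph.cycleGraph 6)) := by
  rcases h with ⟨a, b, c, d, h, rfl⟩ | ⟨he, h, rfl⟩
  · exact Or.inl (induce_edge_iso h)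
  · exact Or.inr ⟨he, induce_hexagon_iso h⟩

theorem IsTile.connected {e : Prop} {τ : Finset HexVertex} (h : IsTile e τ) :
    (honeycomb.induce {x | x ∈ τ}).Connected := by
  rcases h.iso with ⟨⟨f⟩⟩ | ⟨-, ⟨f⟩⟩
  · exact f.connected_iff.2 SimpleGraph.connected_top
  · exact f.connected_iff.2 SimpleGraph.cycleGraph_connected

/-- The honeycomb restricted to `τ`, seen on a set of vertices of a subtype. -/
def induceIsoOfMemIff (τ : Finset HexVertex) (hτ : ∀ v ∈ τ, p v) (s : Set {v // p v})
    (hs : ∀ u, u ∈ s ↔ u.1 ∈ τ) :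
    (honeycomb.comap (Subtype.val : {v // p v} → HexVertex)).induce s ≃g
      honeycomb.induce {x | x ∈ τ} where
  toFun u := ⟨u.1.1, (hs u.1).1 u.2⟩
  invFun v := ⟨⟨v.1, hτ v.1 v.2⟩, (hs _).2 v.2⟩
  left_inv _ := rfl
  right_inv _ := rfl
  map_rel_iff' := Iff.rfl

variable {e : Prop} {V : Finset HexVertex} {T : Finset (Finset HexVertex)}

/-- Tiles are disjoint, so no path leaves a tile, and each tile is connected. -/
theorem mem_supp_tilingGraph (hV : ∀ v, v ∈ V ↔ p v) (hT : IsExactCover (IsTile e) V T)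
    {τ : Finset HexVertex} (hτ : τ ∈ T) {v : {v // p v}} (hv : v.1 ∈ τ) (u : {v // p v}) :
    u ∈ ((tilingGraph p T).connectedComponentMk v).supp ↔ u.1 ∈ τ := by
  rw [SimpleGraph.ConnectedComponent.mem_supp_iff, SimpleGraph.ConnectedComponent.eq]
  constructor
  · intro h
    rw [SimpleGraph.reachable_iff_reflTransGen] at h
    induction h using Relation.ReflTransGen.head_induction_on with
    | refl => exact hv
    | head h _ ih =>
      obtain ⟨-, σ, hσ, h1, h2⟩ := h
      rwa [← (hT.2 _ ((hV _).2 (Subtype.property _))).unique ⟨hσ, h2⟩ ⟨hτ, ih⟩]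
  · intro hu
    let f : honeycomb.induce {x | x ∈ τ} →g tilingGraph p T :=
      { toFun := fun w => ⟨w.1, (hV _).1 ((hT.1 τ hτ).2 w.2)⟩
        map_rel' := fun {x y} h => ⟨h, τ, hτ, x.2, y.2⟩ }
    exact ((hT.1 τ hτ).1.connected.preconnected ⟨u.1, hu⟩ ⟨v.1, hv⟩).map f

theorem isCover_tilingGraph {G : SimpleGraph {v // p v}}
    (hG : ∀ u v, G.Adj u v ↔ honeycomb.Adj u.1 v.1) (hV : ∀ v, v ∈ V ↔ p v)
    (hT : IsExactCover (IsTile e) V T) : IsCover e G (tilingGraph p T) := by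
  refine ⟨fun u v h => (hG u v).2 h.1, fun c => ?_⟩
  induction c using SimpleGraph.ConnectedComponent.ind with
  | _ v =>
    obtain ⟨τ, ⟨hτ, hv⟩, -⟩ := hT.2 v.1 ((hV _).2 v.2)
    have hs := mem_supp_tilingGraph hV hT hτ hv
    have heq : ((tilingGraph p T).connectedComponentMk v).toSimpleGraph =
        (honeycomb.comap (Subtype.val : {v // p v} → HexVertex)).induce
          ((tilingGraph p T).connectedComponentMk v).supp := by
      ext x y
      exact ⟨fun h => h.1, fun h => ⟨h, τ, hτ, (hs _).1 x.2, (hs _).1 y.2⟩⟩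
    have f := induceIsoOfMemIff τ (fun v hv => (hV v).1 ((hT.1 τ hτ).2 hv)) _ hs
    unfold IsDoubleBond IsSextet
    rw [heq]
    rcases (hT.1 τ hτ).1.iso with ⟨⟨g⟩⟩ | ⟨he, ⟨g⟩⟩
    · exact Or.inl ⟨f.trans g⟩
    · exact Or.inr ⟨he, ⟨f.trans g⟩⟩

/-- The tiles are recovered from the graph as the supports of its components; this gives injectivity
in `card_isCover`. -/
theorem tilingGraph_subset (hV : ∀ v, v ∈ V ↔ p v) {T' : Finset (Finset HexVertex)}
    (hT : IsExactCover (IsTile e) V T) (hT' : IsExactCover (IsTile e) V T')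
    (h : tilingGraph p T = tilingGraph p T') : T ⊆ T' := by
  intro τ hτ
  obtain ⟨v, hv⟩ := (hT.1 τ hτ).1.nonempty
  have hvV := (hT.1 τ hτ).2 hv
  obtain ⟨τ', ⟨hτ', hv'⟩, -⟩ := hT'.2 v hvV
  have h1 := mem_supp_tilingGraph hV hT hτ (v := ⟨v, (hV v).1 hvV⟩) hv
  have h2 := mem_supp_tilingGraph hV hT' hτ' (v := ⟨v, (hV v).1 hvV⟩) hv'
  rw [h] at h1
  have : τ = τ' := by
    ext w
    constructor
    · intro hw
      exact (h2 ⟨w, (hV w).1 ((hT.1 τ hτ).2 hw)⟩).1 ((h1 _).2 hw)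
    · intro hw
      exact (h1 ⟨w, (hV w).1 ((hT'.1 τ' hτ').2 hw)⟩).1 ((h2 _).2 hw)
  rwa [this]

/-- The components of a cover are tiles, and they are induced subgraphs of the honeycomb. -/
theorem IsCover.component {G H : SimpleGraph {v // p v}}
    (hG : ∀ u v, G.Adj u v ↔ honeycomb.Adj u.1 v.1) (hH : IsCover e G H)
    (c : H.ConnectedComponent) (τ : Finset HexVertex) (hτp : ∀ v ∈ τ, p v)
    (hτ : ∀ u, u ∈ c.supp ↔ u.1 ∈ τ) :
    IsTile e τ ∧ ∀ u v : {v // p v}, u.1 ∈ τ → v.1 ∈ τ → honeycomb.Adj u.1 v.1 → H.Adj u v := by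
  have f := induceIsoOfMemIff τ hτp _ hτ
  have hfin : Finite c.supp := Finite.of_equiv {x | x ∈ τ} f.symm.toEquiv
  have hle : c.toSimpleGraph ≤
      (honeycomb.comap (Subtype.val : {v // p v} → HexVertex)).induce c.supp :=
    fun x y h => (hG _ _).1 (hH.1 h)
  have hadj : ∀ {β : Type} {K : SimpleGraph β} (_ : c.toSimpleGraph ≃g K)
      (_ : honeycomb.induce {x | x ∈ τ} ≃g K),
      ∀ u v : {v // p v}, u.1 ∈ τ → v.1 ∈ τ → honeycomb.Adj u.1 v.1 → H.Adj u v := by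
    intro β K g g' u v hu hv huv
    have := SimpleGraph.eq_of_le_of_iso hle g (f.trans g')
    rw [← SimpleGraph.ConnectedComponent.toSimpleGraph_adj c ((hτ u).2 hu) ((hτ v).2 hv), this]
    exact huv
  rcases hH.2 c with ⟨⟨g⟩⟩ | ⟨he, ⟨g⟩⟩
  · have h01 : honeycomb.Adj (g.symm 0).1.1 (g.symm 1).1.1 :=
      (hG _ _).1 (hH.1 (g.symm.map_rel_iff.2 (show (0 : Fin 2) ≠ 1 by decide)))
    have hτ2 : τ = {(g.symm 0).1.1, (g.symm 1).1.1} := by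
      ext w
      simp only [Finset.mem_insert, Finset.mem_singleton]
      constructor
      · intro hw
        have hw' := (hτ ⟨w, hτp w hw⟩).2 hw
        have : ∀ i : Fin 2, i = 0 ∨ i = 1 := by decide
        rcases this (g ⟨⟨w, hτp w hw⟩, hw'⟩) with h | h
        · left
          rw [← h, g.symm_apply_apply]
        · right
          rw [← h, g.symm_apply_apply]
      · rintro (rfl | rfl)
        · exact (hτ _).1 (g.symm 0).2
        · exact (hτ _).1 (g.symm 1).2
    have htile : IsTile e τ := by
      left
      generalize (g.symm 0).1.1 = x at h01 hτ2
      generalize (g.symm 1).1.1 = y at h01 hτ2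
      rcases x with ⟨a, b⟩ | ⟨a, b⟩ <;> rcases y with ⟨c, d⟩ | ⟨c, d⟩
      · exact absurd h01 not_honeycomb_adj_A_A
      · exact ⟨a, b, c, d, h01, hτ2⟩
      · exact ⟨c, d, a, b, h01.symm, by rw [hτ2, Finset.pair_comm]⟩
      · exact absurd h01 not_honeycomb_adj_B_B
    refine ⟨htile, ?_⟩
    obtain ⟨g'⟩ := induce_edge_iso h01
    rw [← hτ2] at g'
    exact hadj g g'
  · have hcyc : ∀ i : Fin 6, honeycomb.Adj (g.symm i).1.1 (g.symm (i + 1)).1.1 := by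
      intro i
      refine (hG _ _).1 (hH.1 (g.symm.map_rel_iff.2 ?_))
      have : (SimpleGraph.cycleGraph 6).Adj i (i + 1) ↔ i - (i + 1) = 1 ∨ (i + 1) - i = 1 :=
        SimpleGraph.cycleGraph_adj
      rw [this]
      right
      simp
    have hinj : Function.Injective fun i => (g.symm i).1.1 := fun i j h =>
      g.symm.injective (Subtype.ext (Subtype.ext h))
    obtain ⟨h, hh⟩ := exists_hexagon_of_sixCycle _ hinj hcyc
    have hτ6 : τ = Finset.univ.image fun i => (g.symm i).1.1 := by
      ext w
      simp only [Finset.mem_image, Finset.mem_univ, true_and]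
      constructor
      · intro hw
        refine ⟨g ⟨⟨w, hτp w hw⟩, (hτ _).2 hw⟩, ?_⟩
        rw [g.symm_apply_apply]
      · rintro ⟨i, rfl⟩
        exact (hτ _).1 (g.symm i).2
    have hhex : τ = hexagon h := by
      apply Finset.eq_of_subset_of_card_le
      · rw [hτ6]
        intro w hw
        obtain ⟨i, -, rfl⟩ := Finset.mem_image.1 hw
        exact hh i
      · rw [card_hexagon, hτ6, Finset.card_image_of_injective _ hinj]
        simp
    refine ⟨Or.inr ⟨he, h, hhex⟩, ?_⟩
    obtain ⟨g'⟩ := induce_hexagon_iso h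
    rw [← hhex] at g'
    exact hadj g g'

open Classical in
theorem IsCover.exists_tiling {G H : SimpleGraph {v // p v}}
    (hG : ∀ u v, G.Adj u v ↔ honeycomb.Adj u.1 v.1) (hV : ∀ v, v ∈ V ↔ p v)
    (hH : IsCover e G H) : ∃ T, IsExactCover (IsTile e) V T ∧ tilingGraph p T = H := by
  let T := V.powerset.filter fun τ =>
    ∃ c : H.ConnectedComponent, ∀ u : {v // p v}, u ∈ c.supp ↔ u.1 ∈ τ
  have hT : ∀ τ, τ ∈ T ↔ τ ⊆ V ∧
      ∃ c : H.ConnectedComponent, ∀ u : {v // p v}, u ∈ c.supp ↔ u.1 ∈ τ := fun τ => by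
    simp [T]
  have hcomp : ∀ v : {v // p v}, ∃ τ ∈ T, ∀ u, u ∈ (H.connectedComponentMk v).supp ↔ u.1 ∈ τ := by
    intro v
    have h : ∀ u : {v // p v}, u ∈ (H.connectedComponentMk v).supp ↔
        u.1 ∈ V.filter fun w => ∃ hw : p w, ⟨w, hw⟩ ∈ (H.connectedComponentMk v).supp := by
      rintro ⟨u, hu⟩
      simp [hV, hu]
    exact ⟨_, (hT _).2 ⟨Finset.filter_subset _ _, _, h⟩, h⟩
  refine ⟨T, ⟨fun τ hτ => ?_, fun v hv => ?_⟩, ?_⟩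
  · obtain ⟨hsub, c, hc⟩ := (hT τ).1 hτ
    exact ⟨(hH.component hG c τ (fun v hv => (hV v).1 (hsub hv)) hc).1, hsub⟩
  · obtain ⟨τ, hτ, h⟩ := hcomp ⟨v, (hV v).1 hv⟩
    refine ⟨τ, ⟨hτ, (h ⟨v, _⟩).1 rfl⟩, ?_⟩
    rintro σ ⟨hσ, hvσ⟩
    obtain ⟨hsub, c, hc⟩ := (hT σ).1 hσ
    have hc' : H.connectedComponentMk ⟨v, (hV v).1 hv⟩ = c := (hc ⟨v, (hV v).1 hv⟩).2 hvσ
    subst hc'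
    ext w
    constructor
    · intro hw
      exact (h ⟨w, (hV w).1 (hsub hw)⟩).1 ((hc _).2 hw)
    · intro hw
      exact (hc ⟨w, (hV w).1 (((hT τ).1 hτ).1 hw)⟩).1 ((h _).2 hw)
  · ext u v
    constructor
    · rintro ⟨huv, τ, hτ, hu, hv⟩
      obtain ⟨hsub, c, hc⟩ := (hT τ).1 hτ
      exact (hH.component hG c τ (fun v hv => (hV v).1 (hsub hv)) hc).2 u v hu hv huv
    · intro huv
      obtain ⟨τ, hτ, h⟩ := hcomp u
      refine ⟨(hG u v).1 (hH.1 huv), τ, hτ, (h u).1 rfl, (h v).1 ?_⟩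
      rw [SimpleGraph.ConnectedComponent.mem_supp_iff, SimpleGraph.ConnectedComponent.eq]
      exact huv.symm.reachable

/-- Covers of an induced subgraph of the honeycomb correspond to tilings of its vertex set. -/
theorem card_isCover (e : Prop) {G : SimpleGraph {v // p v}}
    (hG : ∀ u v, G.Adj u v ↔ honeycomb.Adj u.1 v.1) (hV : ∀ v, v ∈ V ↔ p v) :
    Nat.card {H // IsCover e G H} = numTilings e V := by
  rw [numTilings, ← Nat.card_eq_finsetCard]
  refine (Nat.card_congr (Equiv.ofBijective (fun T => ⟨tilingGraph p T.1,
    isCover_tilingGraph hG hV (mem_exactCovers.1 T.2)⟩) ⟨fun T T' h => ?_, fun H => ?_⟩)).symm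
  · have h := congrArg Subtype.val h
    have hT := mem_exactCovers.1 T.2
    have hT' := mem_exactCovers.1 T'.2
    exact Subtype.ext ((tilingGraph_subset hV hT hT' h).antisymm
      (tilingGraph_subset hV hT' hT h.symm))
  · obtain ⟨T, hT, h⟩ := H.2.exists_tiling hG hV
    exact ⟨⟨T, mem_exactCovers.2 hT⟩, Subtype.ext h⟩

end CoverTiling

/-! ### The Zhang–Zhang polynomial at 0 and 1. -/

section ZhangZhang

variable {V : Type*} {G H : SimpleGraph V}

theorem isCover_true_iff : IsCover True G H ↔ IsClarCover G H := by
  simp [IsCover, IsClarCover]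

theorem isCover_false_iff : IsCover False G H ↔ IsKekule G H := by
  simp [IsCover, IsKekule]

theorem IsDoubleBond.not_isSextet {c : H.ConnectedComponent} (h : IsDoubleBond c) :
    ¬ IsSextet c := by
  rintro ⟨g⟩
  obtain ⟨f⟩ := h
  have := Fintype.card_congr (f.symm.trans g).toEquiv
  simp at this

theorem isKekule_iff [Finite V] : IsKekule G H ↔ IsClarCover G H ∧ clarOrder H = 0 := by
  -- `Nat.card` is also 0 on infinite types; finiteness of `V` rules this out.
  rw [clarOrder, Nat.card_eq_zero, or_iff_left (not_infinite_iff_finite.2 inferInstance)]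
  constructor
  · rintro ⟨h1, h2⟩
    exact ⟨⟨h1, fun c => Or.inl (h2 c)⟩, ⟨fun c => (h2 c.1).not_isSextet c.2⟩⟩
  · rintro ⟨⟨h1, h2⟩, h3⟩
    exact ⟨h1, fun c => (h2 c).resolve_right fun h => h3.false ⟨c, h⟩⟩

theorem numKekule_eq_eval_zzPolynomial [Finite V] (G : SimpleGraph V) :
    numKekule G = (zzPolynomial G).eval 0 := by
  rw [zzPolynomial, Polynomial.eval_finsetSum, Finset.sum_range_succ']
  simp [numKekule, numClarCoversOfOrder, isKekule_iff]

/-- A finite `V` has finitely many graphs, so the supremum is over a bounded set and is not the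
default value 0 of an unbounded one. -/
theorem clarOrder_le_clarNumber [Finite V] (h : IsClarCover G H) :
    clarOrder H ≤ clarNumber G := by
  apply le_csSup
  · have : {k | ∃ H : SimpleGraph V, IsClarCover G H ∧ clarOrder H = k} ⊆
        Set.range (clarOrder : SimpleGraph V → ℕ) := by
      rintro k ⟨H, -, rfl⟩
      exact ⟨H, rfl⟩
    exact ((Set.finite_range _).subset this).bddAbove
  · exact ⟨H, h, rfl⟩

theorem numClarCovers_eq_eval_zzPolynomial [Finite V] (G : SimpleGraph V) :
    numClarCovers G = (zzPolynomial G).eval 1 := by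
  classical
  have := Fintype.ofFinite (SimpleGraph V)
  rw [zzPolynomial, Polynomial.eval_finsetSum]
  simp only [Polynomial.eval_mul, Polynomial.eval_C, Polynomial.eval_pow, Polynomial.eval_X,
    one_pow, mul_one, numClarCovers, numClarCoversOfOrder, Nat.card_eq_fintype_card,
    Fintype.card_subtype]
  rw [Finset.card_eq_sum_card_fiberwise (f := clarOrder) (t := Finset.range (clarNumber G + 1))]
  · simp only [Finset.filter_filter]
  · intro H hH
    simp only [Finset.coe_filter, Finset.mem_univ, true_and, Set.mem_ofPred_eq] at hH
    simpa [Nat.lt_succ_iff] using clarOrder_le_clarNumber hH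

end ZhangZhang

/-! ### Benzenoids as induced subgraphs, and the rectangle. -/

section Benzenoid

variable {S : Set (ℕ × ℕ)}

theorem exists_A_mem_hexagon_iff {a b : ℕ} : (∃ h ∈ S, .A a b ∈ hexagon h) ↔
    (a, b) ∈ S ∨ (1 ≤ b ∧ (a, b - 1) ∈ S) ∨ (1 ≤ a ∧ (a - 1, b) ∈ S) := by
  constructor
  · rintro ⟨⟨c, d⟩, h, hm⟩
    rcases A_mem_hexagon.1 hm with ⟨rfl, rfl⟩ | ⟨rfl, rfl⟩ | ⟨rfl, rfl⟩ <;> simp [h]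
  · rintro (h | ⟨h0, h⟩ | ⟨h0, h⟩)
    · exact ⟨_, h, A_mem_hexagon.2 (by omega)⟩
    · exact ⟨_, h, A_mem_hexagon.2 (by omega)⟩
    · exact ⟨_, h, A_mem_hexagon.2 (by omega)⟩

theorem exists_B_mem_hexagon_iff {a b : ℕ} : (∃ h ∈ S, .B a b ∈ hexagon h) ↔
    (1 ≤ b ∧ (a, b - 1) ∈ S) ∨ (1 ≤ a ∧ 1 ≤ b ∧ (a - 1, b - 1) ∈ S) ∨
      (1 ≤ a ∧ (a - 1, b) ∈ S) := by
  constructor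
  · rintro ⟨⟨c, d⟩, h, hm⟩
    rcases B_mem_hexagon.1 hm with ⟨rfl, rfl⟩ | ⟨rfl, rfl⟩ | ⟨rfl, rfl⟩ <;> simp [h]
  · rintro (⟨h0, h⟩ | ⟨h0, h1, h⟩ | ⟨h0, h⟩)
    · exact ⟨_, h, B_mem_hexagon.2 (by omega)⟩
    · exact ⟨_, h, B_mem_hexagon.2 (by omega)⟩
    · exact ⟨_, h, B_mem_hexagon.2 (by omega)⟩

/-- A benzenoid is an induced subgraph of the honeycomb if every lattice edge between two of its
vertices belongs to one of its cells. -/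
theorem benzenoid_adj_iff
    (h₀ : ∀ a b, (∃ h ∈ S, .A a b ∈ hexagon h) → (∃ h ∈ S, .B a b ∈ hexagon h) →
      (1 ≤ b ∧ (a, b - 1) ∈ S) ∨ (1 ≤ a ∧ (a - 1, b) ∈ S))
    (h₁ : ∀ a b, (∃ h ∈ S, .A a b ∈ hexagon h) → (∃ h ∈ S, .B (a + 1) b ∈ hexagon h) →
      (a, b) ∈ S ∨ (1 ≤ b ∧ (a, b - 1) ∈ S))
    (h₂ : ∀ a b, (∃ h ∈ S, .A a b ∈ hexagon h) → (∃ h ∈ S, .B a (b + 1) ∈ hexagon h) →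
      (a, b) ∈ S ∨ (1 ≤ a ∧ (a - 1, b) ∈ S))
    (u v : {v : HexVertex // ∃ h ∈ S, v ∈ hexagon h}) :
    (benzenoid S).Adj u v ↔ honeycomb.Adj u.1 v.1 := by
  have key : ∀ a b c d, honeycomb.Adj (.A a b) (.B c d) → (∃ h ∈ S, .A a b ∈ hexagon h) →
      (∃ h ∈ S, .B c d ∈ hexagon h) → ∃ h ∈ S, .A a b ∈ hexagon h ∧ .B c d ∈ hexagon h := by
    intro a b c d hadj hA hB
    rcases honeycomb_adj_A_B.1 hadj with ⟨rfl, rfl⟩ | ⟨rfl, rfl⟩ | ⟨rfl, rfl⟩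
    · rcases h₀ _ _ hA hB with ⟨h, hS⟩ | ⟨h, hS⟩
      · exact ⟨_, hS, A_mem_hexagon.2 (by omega), B_mem_hexagon.2 (by omega)⟩
      · exact ⟨_, hS, A_mem_hexagon.2 (by omega), B_mem_hexagon.2 (by omega)⟩
    · rcases h₁ _ _ hA hB with hS | ⟨h, hS⟩
      · exact ⟨_, hS, A_mem_hexagon.2 (by omega), B_mem_hexagon.2 (by omega)⟩
      · exact ⟨_, hS, A_mem_hexagon.2 (by omega), B_mem_hexagon.2 (by omega)⟩
    · rcases h₂ _ _ hA hB with hS | ⟨h, hS⟩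
      · exact ⟨_, hS, A_mem_hexagon.2 (by omega), B_mem_hexagon.2 (by omega)⟩
      · exact ⟨_, hS, A_mem_hexagon.2 (by omega), B_mem_hexagon.2 (by omega)⟩
  refine ⟨fun h => h.1, fun h => ⟨h, ?_⟩⟩
  obtain ⟨⟨a, b⟩ | ⟨a, b⟩, hu⟩ := u <;> obtain ⟨⟨c, d⟩ | ⟨c, d⟩, hv⟩ := v
  · exact absurd h not_honeycomb_adj_A_A
  · exact key a b c d h hu hv
  · obtain ⟨x, hx, h1, h2⟩ := key c d a b h.symm hv hu
    exact ⟨x, hx, h2, h1⟩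
  · exact absurd h not_honeycomb_adj_B_B

theorem exists_finset_vertices (hS : S.Finite) :
    ∃ V : Finset HexVertex, ∀ v, v ∈ V ↔ ∃ h ∈ S, v ∈ hexagon h :=
  ⟨hS.toFinset.biUnion hexagon, by simp⟩

theorem card_isCover_benzenoid_empty (e : Prop) (hS : S = ∅) :
    Nat.card {H // IsCover e (benzenoid S) H} = 1 := by
  subst hS
  rw [card_isCover e (V := ∅) (fun u => absurd u.2 (by simp)) (by simp), numTilings]
  exact card_exactCovers_empty fun _ h => h.nonempty

-- The offset `r` serves the two degenerate ribbons, with `r = 0` and `r = n₂`.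
open Classical in
theorem card_isCover_rectangle (e : Prop) {r n m : ℕ}
    (hS : ∀ h, h ∈ S ↔ r ≤ h.1 ∧ h.1 < r + n ∧ h.2 < m) :
    Nat.card {H // IsCover e (benzenoid S) H} = delannoy (1 + if e then 1 else 0) n m := by
  by_cases h0 : n = 0 ∨ m = 0
  · rw [card_isCover_benzenoid_empty]
    · rcases h0 with rfl | rfl <;> simp
    · ext h
      rw [hS]
      simp only [Set.mem_empty_iff_false, iff_false]
      omega
  · have hfin : S.Finite := 
      (Set.finite_Iic (r + n, m)).subset fun h hh => by
        have := (hS h).1 hh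
        exact Prod.le_def.2 ⟨by simp only; omega, by simp only; omega⟩
    obtain ⟨V, hV⟩ := exists_finset_vertices hfin
    have hreg : IsRegion (fun a b => r ≤ a ∧ a ≤ r + n ∧ b ≤ m) (r, 0) (r + n, m) V := by
      refine ⟨fun a b => ?_, fun a b => ?_, fun a b h => ?_, fun a b h => ?_⟩
      · rw [hV, exists_A_mem_hexagon_iff]
        simp only [hS, ne_eq, Prod.mk.injEq]
        omega
      · rw [hV, exists_B_mem_hexagon_iff]
        simp only [hS, ne_eq, Prod.mk.injEq]
        omega
      · simp only
        omega
      · simp only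
        omega
    rw [card_isCover e _ hV, ← hreg.pathRest_source]
    · have := hreg.numTilings_pathRest_rectangle e r (fun a b h1 _ h2 h3 => ⟨h1, h2, h3⟩) n m
        le_rfl (by simp)
      simpa using this
    · apply benzenoid_adj_iff
      all_goals
        intro a b hA hB
        rw [exists_A_mem_hexagon_iff] at hA
        rw [exists_B_mem_hexagon_iff] at hB
        simp only [hS] at hA hB ⊢
        omega

end Benzenoid

/-! ### Counting the covers of a ribbon. -/

theorem finite_ribbonCells (n₁ n₂ m₁ m₂ : ℕ) : (ribbonCells n₁ n₂ m₁ m₂).Finite :=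
  (Set.finite_Iic (n₂ + n₁, m₁ + m₂)).subset fun h hh => by
    simp only [ribbonCells, Set.mem_ofPred_eq] at hh
    exact Prod.le_def.2 ⟨by simp only; omega, by simp only; omega⟩

open Classical in
/-- The number of covers of a ribbon: a path from the source to the sink of the ribbon meets the
antidiagonal through the inner corner or jumps over it. -/
theorem card_isCover_ribbon (e : Prop) (n₁ n₂ m₁ m₂ x : ℕ) (hx : x = 1 + if e then 1 else 0) :
    Nat.card {H // IsCover e (ribbon n₁ n₂ m₁ m₂) H} =
      ∑ k ∈ Finset.Icc 0 (min n₁ m₁), delannoy x (n₂ + k) (m₁ - k) * delannoy x (m₂ + k) (n₁ - k) +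
      (if e then 1 else 0) * ∑ k ∈ Finset.Icc 1 (min n₁ m₁),
        delannoy x (n₂ + k - 1) (m₁ - k) * delannoy x (m₂ + k - 1) (n₁ - k) := by
  -- If n₁ or m₁ is 0, `ribbonPos` can contain a tail of positions carrying no vertices. The ribbon
  -- is then a single rectangle, and only the term k = 0 survives.
  rcases Nat.eq_zero_or_pos n₁ with rfl | hn
  · rw [card_isCover_rectangle e (r := 0) (n := n₂) (m := m₁)]
    · simp [hx]
    · intro h
      simp only [ribbonCells, Set.mem_ofPred_eq]
      omega
  rcases Nat.eq_zero_or_pos m₁ with rfl | hm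
  · rw [card_isCover_rectangle e (r := n₂) (n := n₁) (m := m₂)]
    · simp [hx, delannoy_comm _ n₁]
    · intro h
      simp only [ribbonCells, Set.mem_ofPred_eq]
      omega
  have hS : ∀ h, h ∈ ribbonCells n₁ n₂ m₁ m₂ ↔
      h.1 < n₂ + n₁ ∧ h.2 < m₁ + m₂ ∧ (h.1 < n₂ → h.2 < m₁) := by
    intro h
    simp only [ribbonCells, Set.mem_ofPred_eq]
    omega
  obtain ⟨V, hV⟩ := exists_finset_vertices (finite_ribbonCells n₁ n₂ m₁ m₂)
  have hreg : IsRegion (ribbonPos n₁ n₂ m₁ m₂) (0, 0) (n₂ + n₁, m₁ + m₂) V := by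
    refine ⟨fun a b => ?_, fun a b => ?_, fun a b h => ?_, fun a b h => ?_⟩
    · rw [hV, exists_A_mem_hexagon_iff]
      simp only [hS, ne_eq, Prod.mk.injEq, ribbonPos]
      omega
    · rw [hV, exists_B_mem_hexagon_iff]
      simp only [hS, ne_eq, Prod.mk.injEq, ribbonPos]
      omega
    · simp
    · exact ⟨h.1, h.2.1⟩
  rw [card_isCover e _ hV, hreg.numTilings_ribbon hm e x hx]
  apply benzenoid_adj_iff
  all_goals
    intro a b hA hB
    rw [exists_A_mem_hexagon_iff] at hA
    rw [exists_B_mem_hexagon_iff] at hB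
    simp only [hS] at hA hB ⊢
    omega

theorem delannoy_mul_delannoy (x n m n' m' : ℕ) :
    delannoy x n m * delannoy x n' m' =
      ∑ j ∈ Finset.Icc 0 m, ∑ i ∈ Finset.Icc 0 m',
        m.choose j * n.choose j * (n'.choose i * m'.choose i) * x ^ (i + j) := by
  rw [delannoy, delannoy, Finset.sum_mul_sum, Nat.range_succ_eq_Icc_zero,
    Nat.range_succ_eq_Icc_zero]
  exact Finset.sum_congr rfl fun j _ => Finset.sum_congr rfl fun i _ => by ring

theorem finite_ribbon_vertices (n₁ n₂ m₁ m₂ : ℕ) :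
    Finite {v : HexVertex // ∃ h ∈ ribbonCells n₁ n₂ m₁ m₂, v ∈ hexagon h} := by
  obtain ⟨V, hV⟩ := exists_finset_vertices (finite_ribbonCells n₁ n₂ m₁ m₂)
  exact Finite.of_equiv V (Equiv.subtypeEquivRight hV)

theorem mainTheorem2 (n₁ n₂ m₁ m₂ : ℕ) :
    (numKekule (ribbon n₁ n₂ m₁ m₂) = (zzPolynomial (ribbon n₁ n₂ m₁ m₂)).eval 0 ∧
      numKekule (ribbon n₁ n₂ m₁ m₂) =
        ∑ k ∈ Finset.Icc 0 (min n₁ m₁),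
          ∑ j ∈ Finset.Icc 0 (m₁ - k), ∑ i ∈ Finset.Icc 0 (n₁ - k),
            (m₁ - k).choose j * (n₂ + k).choose j *
              ((m₂ + k).choose i * (n₁ - k).choose i)) ∧
    (numClarCovers (ribbon n₁ n₂ m₁ m₂) = (zzPolynomial (ribbon n₁ n₂ m₁ m₂)).eval 1 ∧
      numClarCovers (ribbon n₁ n₂ m₁ m₂) =
        ∑ k ∈ Finset.Icc 0 (min n₁ m₁),
          ∑ j ∈ Finset.Icc 0 (m₁ - k), ∑ i ∈ Finset.Icc 0 (n₁ - k),
            (m₁ - k).choose j * (n₂ + k).choose j *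
              ((m₂ + k).choose i * (n₁ - k).choose i) * 2 ^ (i + j) +
        ∑ k ∈ Finset.Icc 1 (min n₁ m₁),
          ∑ j ∈ Finset.Icc 0 (m₁ - k), ∑ i ∈ Finset.Icc 0 (n₁ - k),
            (m₁ - k).choose j * (n₂ + k - 1).choose j *
              ((m₂ + k - 1).choose i * (n₁ - k).choose i) * 2 ^ (i + j)) := by
  have := finite_ribbon_vertices n₁ n₂ m₁ m₂
  refine ⟨⟨numKekule_eq_eval_zzPolynomial _, ?_⟩, numClarCovers_eq_eval_zzPolynomial _, ?_⟩
  · have h := card_isCover_ribbon False n₁ n₂ m₁ m₂ 1 (by simp)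
    simpa only [numKekule, isCover_false_iff, delannoy_mul_delannoy, if_false, zero_mul,
      add_zero, one_pow, mul_one] using h
  · have h := card_isCover_ribbon True n₁ n₂ m₁ m₂ 2 (by simp)
    simpa only [numClarCovers, isCover_true_iff, delannoy_mul_delannoy, if_true, one_mul] using h
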